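/- Let $G$ be a finite $3$-connected cubic graph (such a graph is simple). For two cubic graphs $H$ and $K$, a $3$-sum $H*K$ is a graph obtained by removing a vertex $x$ of $H$ and a vertex $y$ of $K$ and identifying, via some bijection, the three dangling edges of $H-x$ with the three dangling edges of $K-y$. A set $B$ of edges of a graph is cycle-separating if its removal leaves a disconnected graph at least two components of which contain cycles, and a connected graph is cyclically $4$-edge-connected if it has no cycle-separating set of fewer than four edges. A canonical decomposition of $G$ is a collection $\{G_1,\dots,G_r\}$ of simple cyclically $4$-edge-connected cubic graphs (the factors, counted with multiplicity) from which $G$ can be reconstructed, up to isomorphism, by repeated $3$-sums; for every $3$-connected cubic graph it exists and is unique up to isomorphism and order of the factors. A connected graph is cyclically odd if its Betti number $\beta = |E|-|V|+1$ is odd. Theorem 6.2. If the canonical decomposition of $G$ contains at most one cyclically odd factor, then $G$ admits a coherent decycling partition, that is, a partition $\{A,J\}$ of $V(G)$ such that $J$ is a minimum decycling set (a set of vertices of smallest size whose removal leaves an acyclic graph), $J$ is independent or induces a subgraph with exactly one edge, and $A=V(G)\setminus J$ induces a tree. -/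

import Mathlib

namespace CubicDecycling

universe u v

section Basic

variable {V : Type u}

/-- Every vertex has exactly three neighbours. -/
def IsCubic (G : SimpleGraph V) : Prop :=
  ∀ x, (G.neighborSet x).ncard = 3

/-- `k`-(vertex-)connectivity of a finite graph: more than `k` vertices, and deleting fewer than `k`
vertices never disconnects the graph. -/
def IsVertexConnected (k : ℕ) (G : SimpleGraph V) : Prop :=
  k < Nat.card V ∧ ∀ S : Set V, S.ncard < k → (G.induce Sᶜ).Connected

/-- A set `B` of edges is cycle-separating if at least two (different) components of `G - B`
contain cycles; in particular `G - B` is then disconnected. -/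
def IsCycleSeparating (G : SimpleGraph V) (B : Set (Sym2 V)) : Prop :=
  B ⊆ G.edgeSet ∧ ∃ C D : (G.deleteEdges B).ConnectedComponent,
    C ≠ D ∧ ¬ C.toSimpleGraph.IsAcyclic ∧ ¬ D.toSimpleGraph.IsAcyclic

/-- A connected graph without a cycle-separating set of fewer than `k` edges. -/
def IsCyclicallyEdgeConnected (k : ℕ) (G : SimpleGraph V) : Prop :=
  G.Connected ∧ ∀ B : Set (Sym2 V), B.encard < k → ¬ IsCycleSeparating G B

/-- The Betti number `|E| - |V| + 1` of a (finite connected) graph. -/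
noncomputable def bettiNumber (G : SimpleGraph V) : ℤ :=
  (G.edgeSet.ncard : ℤ) - (Nat.card V : ℤ) + 1

/-- The Betti number is odd. -/
def IsCyclicallyOdd (G : SimpleGraph V) : Prop :=
  Odd (bettiNumber G)

/-- Deleting `J` destroys all cycles. -/
def IsDecyclingSet (G : SimpleGraph V) (J : Set V) : Prop :=
  (G.induce Jᶜ).IsAcyclic

/-- A decycling set of smallest cardinality (in a finite graph). -/
def IsMinimumDecyclingSet (G : SimpleGraph V) (J : Set V) : Prop :=
  IsDecyclingSet G J ∧ ∀ J' : Set V, IsDecyclingSet G J' → J.ncard ≤ J'.ncard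

/-- `J` induces a subgraph with exactly one edge. -/
def IsNearIndependent (G : SimpleGraph V) (J : Set V) : Prop :=
  (G.induce J).edgeSet.ncard = 1

/-- A stable decycling partition `{A, J}`: `J` is a minimum decycling set that is independent or
near-independent, and its complement `A` induces a forest with at most two components. -/
structure IsStableDecyclingPartition (G : SimpleGraph V) (A J : Set V) : Prop where
  isCompl : IsCompl A J
  minimum : IsMinimumDecyclingSet G J
  indep_or_near : G.IsIndepSet J ∨ IsNearIndependent G J
  forest : (G.induce A).IsAcyclic
  components : Nat.card (G.induce A).ConnectedComponent ≤ 2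

/-- A stable decycling partition `{A, J}` is coherent if `A` induces a tree. -/
structure IsCoherentDecyclingPartition (G : SimpleGraph V) (A J : Set V) : Prop where
  stable : IsStableDecyclingPartition G A J
  tree : (G.induce A).IsTree

end Basic

section ThreeSum

variable {V : Type u} {W : Type v}

/-- Delete the root vertices `x` of `H` and `y` of `K`, and identify the dangling edges of `H - x`
with the dangling edges of `K - y`. In a simple graph the dangling edges of `H - x` correspond to
the neighbours of `x`, so the identification is a bijection `σ` between the neighbours of `x` and
the neighbours of `y`, and the new edges are those joining each neighbour `a` of `x` to `σ a`. -/
def rootedSum (H : SimpleGraph V) (x : V) (K : SimpleGraph W) (y : W)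
    (σ : H.neighborSet x ≃ K.neighborSet y) :
    SimpleGraph ({a : V // a ≠ x} ⊕ {b : W // b ≠ y}) where
  Adj p q :=
    match p, q with
    | Sum.inl a, Sum.inl a' => H.Adj a a'
    | Sum.inr b, Sum.inr b' => K.Adj b b'
    | Sum.inl a, Sum.inr b => ∃ h : (a : V) ∈ H.neighborSet x, (σ ⟨a, h⟩ : W) = b
    | Sum.inr b, Sum.inl a => ∃ h : (a : V) ∈ H.neighborSet x, (σ ⟨a, h⟩ : W) = b
  symm := ⟨by
    rintro (a | b) (a' | b') h
    · exact (show H.Adj _ _ from h).symm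
    · exact h
    · exact h
    · exact (show K.Adj _ _ from h).symm⟩
  loopless := ⟨by
    rintro (a | b) h
    · exact H.irrefl h
    · exact K.irrefl h⟩

/-- `G` is, up to isomorphism, a `3`-sum `H * K` of the cubic graphs `H` and `K`. -/
def IsThreeSum {U : Type*} (G : SimpleGraph U) (H : SimpleGraph V) (K : SimpleGraph W) : Prop :=
  IsCubic H ∧ IsCubic K ∧
    ∃ (x : V) (y : W) (σ : H.neighborSet x ≃ K.neighborSet y),
      Nonempty (G ≃g rootedSum H x K y σ)

end ThreeSum

/-- A graph together with its vertex type, so that collections of graphs can be formed. -/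
structure BundledGraph : Type (u + 1) where
  verts : Type u
  graph : SimpleGraph verts

/-- `IsCanonicalDecomposition G L`: the collection `L` (with multiplicities) consists of cyclically
`4`-edge-connected cubic graphs, the factors, from which `G` can be reconstructed by repeated
`3`-sums. For a `3`-connected cubic graph `G` such an `L` exists and is unique up to isomorphism of
the factors. -/
inductive IsCanonicalDecomposition :
    ∀ {V : Type u}, SimpleGraph V → Multiset BundledGraph.{u} → Prop
  | factor {V : Type u} (G : SimpleGraph V) (hcubic : IsCubic G)
      (hconn : IsCyclicallyEdgeConnected 4 G) :
      IsCanonicalDecomposition G {⟨V, G⟩}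
  | sum {U V W : Type u} (G : SimpleGraph U) (H : SimpleGraph V) (K : SimpleGraph W)
      (L M : Multiset BundledGraph.{u}) (hH : IsCanonicalDecomposition H L)
      (hK : IsCanonicalDecomposition K M) (hG : IsThreeSum G H K) :
      IsCanonicalDecomposition G (L + M)

open Classical in
/-- The number of cyclically odd members of a collection of graphs, with multiplicities. -/
noncomputable def cyclicallyOddCount (L : Multiset BundledGraph.{u}) : ℕ :=
  L.countP fun F => IsCyclicallyOdd F.graph

end CubicDecycling

/-! Write n for the number of vertices and e(U) for the number of edges within U. Counting edges
shows that a decycling set has at least (n+2)/4 vertices (`IsDecyclingSet.card_add_two_le`). If J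
spans at most one edge and leaves a tree, then 4|J| is n+2 or n+4, so J is minimum; it remains to
find such a J.

Existence rests on a form of Nebeský's theorem, `IsBalanced.exists_isTreeComplement`, proved by
induction on |S|. Take a partition of S that is tight for the balance inequality and has as many
parts as possible. If it has one part, S is a tree or any vertex of degree 3 can be removed.
Otherwise contract the parts: by uncrossing (`exists_transversal`) each odd part receives its own
incident edge so that the remaining edges form a spanning tree. Solve inside the parts, at an odd
part removing the end of its edge first, and glue.

In a 3-edge-connected cubic graph a proper part C has weight above 3|C|/2 only if it is a side of a
3-edge-cut with 3 modulo 4 vertices. If no two such odd sides are disjoint, a partition gains at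
most 1/2 in total, and rounding gives balance: for all of V when n is 2 modulo 4, and for V minus
two adjacent vertices when n is 0 modulo 4. These two vertices account for the single edge in J.

Odd sides are traced through the decomposition (`IsCanonicalDecomposition.oddSides`). As 3-edge-cuts
do not cross, each one in a 3-sum comes from a summand, and a summand without odd sides does not
change sizes modulo 4. In a cyclically 4-edge-connected factor a 3-edge-cut isolates one vertex, so
an even factor has no odd side and an odd factor has no two disjoint ones. -/

namespace CubicDecycling

set_option linter.unusedSectionVars false

/-! ### Edge counts and edge boundaries in cubic graphs -/

section Counting

open Finset
open scoped Classical

variable {V : Type*} [Fintype V] (G : SimpleGraph V)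

/-- The edges of `G` with both ends in `U`. -/
noncomputable def edgesWithin (U : Finset V) : Finset (Sym2 V) :=
  {x ∈ G.edgeFinset | ∀ v ∈ x, v ∈ U}

/-- The number of neighbours of `v` in `U`. -/
noncomputable def degreeWithin (U : Finset V) (v : V) : ℕ := #{w ∈ U | G.Adj v w}

/-- The edges leaving `U`, as ordered pairs. -/
noncomputable def boundary (U : Finset V) : Finset (V × V) :=
  {p | G.Adj p.1 p.2 ∧ p.1 ∈ U ∧ p.2 ∉ U}

variable {G}

@[simp] lemma mk_mem_edgesWithin {U : Finset V} {a b : V} :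
    s(a, b) ∈ edgesWithin G U ↔ G.Adj a b ∧ a ∈ U ∧ b ∈ U := by
  simp [edgesWithin]

lemma degreeWithin_mono {U W : Finset V} (h : U ⊆ W) (v : V) :
    degreeWithin G U v ≤ degreeWithin G W v :=
  card_le_card (filter_subset_filter _ h)

lemma card_edgesWithin_insert {U : Finset V} {v : V} (hv : v ∉ U) :
    #(edgesWithin G (insert v U)) = #(edgesWithin G U) + degreeWithin G U v := by
  have h : edgesWithin G (insert v U) =
      edgesWithin G U ∪ {w ∈ U | G.Adj v w}.image (fun w => s(v, w)) := by
    ext x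
    induction x with | _ a b => ?_
    simp only [mk_mem_edgesWithin, mem_union, mem_insert, mem_image, mem_filter, Sym2.eq_iff]
    constructor
    · rintro ⟨h, rfl | ha, rfl | hb⟩
      · exact (h.ne rfl).elim
      · exact Or.inr ⟨b, ⟨hb, h⟩, Or.inl ⟨rfl, rfl⟩⟩
      · exact Or.inr ⟨a, ⟨ha, h.symm⟩, Or.inr ⟨rfl, rfl⟩⟩
      · exact Or.inl ⟨h, ha, hb⟩
    · rintro (⟨h, ha, hb⟩ | ⟨w, ⟨hw, h⟩, ⟨rfl, rfl⟩ | ⟨rfl, rfl⟩⟩)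
      · exact ⟨h, Or.inr ha, Or.inr hb⟩
      · exact ⟨h, Or.inl rfl, Or.inr hw⟩
      · exact ⟨h.symm, Or.inr hw, Or.inl rfl⟩
  rw [h, card_union_of_disjoint, card_image_of_injective, degreeWithin]
  · intro a b hab
    exact Sym2.congr_right.1 hab
  · rw [disjoint_left]
    intro x hx hx'
    obtain ⟨w, -, rfl⟩ := mem_image.1 hx'
    exact hv (mk_mem_edgesWithin.1 hx).2.1

lemma card_edgesWithin_erase {U : Finset V} {v : V} (hv : v ∈ U) :
    #(edgesWithin G U) = #(edgesWithin G (U.erase v)) + degreeWithin G U v := by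
  have h := card_edgesWithin_insert (G := G) (notMem_erase v U)
  rw [insert_erase hv] at h
  rw [h, degreeWithin, degreeWithin]
  congr 2
  ext w
  simp only [mem_filter, mem_erase]
  exact ⟨fun h => ⟨h.1.2, h.2⟩, fun h => ⟨⟨h.2.ne', h.1⟩, h.2⟩⟩

lemma degreeWithin_insert_self (U : Finset V) (v : V) :
    degreeWithin G (insert v U) v = degreeWithin G U v := by
  simp [degreeWithin, filter_insert]

lemma degreeWithin_insert {U : Finset V} {v : V} (hv : v ∉ U) (w : V) :
    degreeWithin G (insert v U) w = degreeWithin G U w + if G.Adj w v then 1 else 0 := by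
  rw [degreeWithin, filter_insert]
  split_ifs with h
  · rw [card_insert_of_notMem (by simp [hv]), degreeWithin]
  · rfl

lemma sum_degreeWithin (U : Finset V) :
    ∑ v ∈ U, degreeWithin G U v = 2 * #(edgesWithin G U) := by
  induction U using Finset.induction_on with
  | empty =>
    have : edgesWithin G ∅ = ∅ := by
      ext x
      induction x with | _ a b => ?_
      simp
    simp [this]
  | insert v U hv ih =>
    rw [sum_insert hv, degreeWithin_insert_self, card_edgesWithin_insert hv,
      sum_congr rfl (fun w _ => degreeWithin_insert hv w), sum_add_distrib, ih, sum_boole]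
    simp only [degreeWithin, SimpleGraph.adj_comm _ v, Nat.cast_id]
    ring

lemma degreeWithin_univ (v : V) : degreeWithin G univ v = (G.neighborSet v).ncard := by
  rw [degreeWithin, ← Set.ncard_coe_finset]
  congr 1
  ext w
  simp

/-- Degree sum over `U`. In particular the boundary of `U` has the parity of `#U`. -/
lemma two_mul_card_edgesWithin_add_card_boundary (hG : IsCubic G) (U : Finset V) :
    2 * #(edgesWithin G U) + #(boundary G U) = 3 * #U := by
  have h : #(boundary G U) = ∑ v ∈ U, #{w | G.Adj v w ∧ w ∉ U} := by
    rw [← card_sigma]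
    refine card_bij' (fun p _ => ⟨p.1, p.2⟩) (fun p _ => (p.1, p.2)) ?_ ?_ ?_ ?_ <;>
      simp +contextual [boundary]
  rw [h, ← sum_degreeWithin, ← sum_add_distrib, sum_congr rfl (g := fun _ => 3)]
  · simp [mul_comm]
  · intro v _
    rw [← hG v, ← degreeWithin_univ, degreeWithin, degreeWithin, ← card_union_of_disjoint]
    · congr 1
      ext w
      simp only [mem_union, mem_filter, mem_univ, true_and]
      tauto
    · rw [disjoint_left]
      simp +contextual

lemma card_boundary_compl (U : Finset V) : #(boundary G Uᶜ) = #(boundary G U) := by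
  refine card_bij' (fun p _ => p.swap) (fun p _ => p.swap) ?_ ?_ ?_ ?_ <;>
    simp +contextual [boundary, SimpleGraph.adj_comm]

lemma card_boundary_inter_add_union_le (S T : Finset V) :
    #(boundary G (S ∩ T)) + #(boundary G (S ∪ T)) ≤ #(boundary G S) + #(boundary G T) := by
  rw [← card_union_add_card_inter, ← card_union_add_card_inter (boundary G S)]
  refine add_le_add (card_le_card ?_) (card_le_card ?_) <;> intro p <;>
    simp only [boundary, mem_union, mem_inter, mem_filter, mem_univ, true_and] <;> tauto

/-- No part of `U` is separated from the rest of `U`, that is, `U` induces a connected subgraph. -/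
def IsLinked (G : SimpleGraph V) (U : Finset V) : Prop :=
  U.Nonempty ∧ ∀ W ⊆ U, W.Nonempty → W ≠ U → ∃ a ∈ W, ∃ b ∈ U \ W, G.Adj a b

end Counting

/-! ### Sparse multigraphs and transversals with spanning-tree complement -/

section Transversal

open Finset

variable {E N : Type*} [DecidableEq E] [DecidableEq N]

/-- The number of edges of a multigraph with all ends in `T`. -/
noncomputable def spanned (ends : E → Finset N) (X : Finset E) (T : Finset N) : ℕ :=
  #{x ∈ X | ends x ⊆ T}

lemma spanned_add_spanned_le (ends : E → Finset N) (X : Finset E) (S T : Finset N) :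
    spanned ends X S + spanned ends X T ≤
      spanned ends X (S ∩ T) + spanned ends X (S ∪ T) := by
  rw [spanned, spanned, ← card_union_add_card_inter, add_comm]
  refine add_le_add (card_le_card ?_) (card_le_card ?_) <;> intro x <;>
    simp only [mem_union, mem_inter, mem_filter]
  · exact fun h => ⟨h.1.1, subset_inter h.1.2 h.2.2⟩
  · rintro (h | h)
    · exact ⟨h.1, h.2.trans subset_union_left⟩
    · exact ⟨h.1, h.2.trans subset_union_right⟩

/-- A multigraph, loopless at the nodes of `O`, which is sparse with an excess of one edge for each
node of `O`, has a system of distinct representatives of `O` by incident edges the removal of which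
leaves a spanning tree. -/
lemma exists_transversal [Nonempty E] (ends : E → Finset N) (M O : Finset N) (hO : O ⊆ M) (X : Finset E)
    (hsparse : ∀ T ⊆ M, T.Nonempty → spanned ends X T + 1 ≤ #T + #(T ∩ O))
    (htight : spanned ends X M + 1 = #M + #O)
    (hloop : ∀ x ∈ X, ∀ o, ¬ ends x ⊆ {o}) :
    ∃ f : N → E, Set.InjOn f O ∧ (∀ o ∈ O, f o ∈ X ∧ o ∈ ends (f o)) ∧
      (∀ T ⊆ M, T.Nonempty → spanned ends (X \ O.image f) T + 1 ≤ #T) ∧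
      spanned ends (X \ O.image f) M + 1 = #M := by
  induction O using Finset.induction_on generalizing X with
  | empty =>
    -- The values of `f` outside `O` are irrelevant.
    exact ⟨fun _ => Classical.arbitrary E, by simp, by simp, by simpa using hsparse,
      by simpa using htight⟩
  | insert o O ho ih =>
    have hoM : o ∈ M := hO (mem_insert_self _ _)
    let tights : Finset (Finset N) :=
      {T ∈ M.powerset | o ∈ T ∧ spanned ends X T + 1 = #T + #(T ∩ insert o O)}
    have hMt : M ∈ tights := by
      simp only [tights, mem_filter, mem_powerset, subset_refl, true_and]
      exact ⟨hoM, by rw [inter_eq_right.2 hO]; exact htight⟩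
    obtain ⟨S, hS, hmin⟩ := exists_min_image tights card ⟨M, hMt⟩
    simp only [tights, mem_filter, mem_powerset] at hS hmin hMt
    obtain ⟨hSM, hoS, hSt⟩ := hS
    -- Uncrossing: `spanned` is supermodular and the bound is modular, so tight sets containing `o`
    -- are closed under intersection, and the smallest one lies in all others.
    have hsub : ∀ T ⊆ M, o ∈ T → spanned ends X T + 1 = #T + #(T ∩ insert o O) → S ⊆ T := by
      intro T hTM hoT hTt
      have h₁ := spanned_add_spanned_le ends X S T
      have h₂ := hsparse (S ∩ T) (inter_subset_left.trans hSM) ⟨o, by simp [hoS, hoT]⟩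
      have h₃ := hsparse (S ∪ T) (union_subset hSM hTM) ⟨o, by simp [hoS]⟩
      have h₄ := card_union_add_card_inter S T
      have h₅ := card_union_add_card_inter (S ∩ insert o O) (T ∩ insert o O)
      rw [← union_inter_distrib_right, ← inter_inter_distrib_right] at h₅
      have h₆ := hmin (S ∩ T) ⟨inter_subset_left.trans hSM, by simp [hoS, hoT], by omega⟩
      exact inter_eq_left.1 (eq_of_subset_of_card_le inter_subset_left h₆)
    -- Otherwise `S.erase o` spans as many edges as `S` while its bound is smaller by two; if `S =
    -- {o}`, tightness would require a loop.
    have hx : ∃ x ∈ X, ends x ⊆ S ∧ o ∈ ends x := by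
      by_contra! h
      have h₁ : spanned ends X (S.erase o) = spanned ends X S := by
        rw [spanned, spanned]
        congr 1
        refine filter_congr fun x hx => ⟨fun h' => h'.trans (erase_subset _ _), fun h' => ?_⟩
        exact subset_erase.2 ⟨h', h x hx h'⟩
      have h₂ : (S.erase o).Nonempty := by
        rw [nonempty_iff_ne_empty]
        intro h₀
        have hS1 : S = {o} := by
          rw [← insert_erase hoS, h₀]; rfl
        have : spanned ends X S = 0 := by
          rw [spanned, card_eq_zero, filter_eq_empty_iff]
          intro x hx
          rw [hS1]
          exact hloop x hx o
        rw [this, hS1] at hSt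
        simp at hSt
      have h₃ := hsparse _ ((erase_subset _ _).trans hSM) h₂
      have h₄ := card_erase_add_one hoS
      have h₅ : #(S.erase o ∩ insert o O) + 1 = #(S ∩ insert o O) := by
        rw [← card_erase_add_one (show o ∈ S ∩ insert o O by simp [hoS]), erase_inter]
      omega
    obtain ⟨x, hxX, hxS, hox⟩ := hx
    have hcount : ∀ T, spanned ends X T =
        spanned ends (X.erase x) T + if ends x ⊆ T then 1 else 0 := by
      intro T
      rw [spanned, spanned, filter_erase]
      split_ifs with h
      · rw [card_erase_add_one (by simp [hxX, h])]
      · rw [erase_eq_of_notMem (by simp [h]), add_zero]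
    have hins : ∀ T, #(T ∩ insert o O) = #(T ∩ O) + if o ∈ T then 1 else 0 := by
      intro T
      split_ifs with h
      · rw [inter_insert_of_mem h, card_insert_of_notMem (by simp [ho])]
      · rw [inter_insert_of_notMem h, add_zero]
    -- Dropping `o` from `O` lowers the bound by one for each `T` containing `o`. A tight `T`
    -- contains `S`, hence loses the edge `x` as well; any other `T` has slack.
    obtain ⟨f, hf, hfX, hfs, hft⟩ := ih ((subset_insert _ _).trans hO) (X.erase x)
      (fun T hT hTn => by
        have h₁ := hsparse T hT hTn
        have h₂ := hcount T
        have h₃ := hins T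
        have h₄ := hsub T hT
        by_cases hoT : o ∈ T
        · by_cases hxT : ends x ⊆ T
          · simp only [hoT, hxT, if_true] at h₂ h₃
            omega
          · have : spanned ends X T + 1 ≠ #T + #(T ∩ insert o O) :=
              fun h => hxT (hxS.trans (h₄ hoT h))
            simp only [hoT, hxT, if_true, if_false] at h₂ h₃
            omega
        · simp only [hoT, if_false] at h₃
          omega)
      (by
        have h₂ := hcount M
        rw [if_pos (hxS.trans hSM)] at h₂
        rw [card_insert_of_notMem ho] at htight
        omega)
      (fun y hy => hloop y (mem_of_mem_erase hy))
    have hne : ∀ o' ∈ O, Function.update f o x o' = f o' := fun o' h' =>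
      Function.update_of_ne (ne_of_mem_of_not_mem h' ho) _ _
    have himg : X \ (insert o O).image (Function.update f o x) = (X.erase x) \ O.image f := by
      rw [image_insert, Function.update_self, image_congr (g := f) hne]
      ext y
      simp only [mem_sdiff, mem_insert, mem_erase]
      tauto
    refine ⟨Function.update f o x, ?_, ?_, ?_, ?_⟩
    · rw [coe_insert, Set.injOn_insert (by simpa using ho)]
      refine ⟨fun a ha b hb hab => hf ha hb ?_, ?_⟩
      · rwa [hne a ha, hne b hb] at hab
      · rintro ⟨a, ha, hab⟩
        rw [Function.update_self, hne a ha] at hab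
        exact notMem_erase x X (hab ▸ (hfX a ha).1)
    · intro a ha
      rcases mem_insert.1 ha with rfl | ha
      · rw [Function.update_self]
        exact ⟨hxX, hox⟩
      · rw [hne a ha]
        exact ⟨mem_of_mem_erase (hfX a ha).1, (hfX a ha).2⟩
    · rw [himg]
      exact hfs
    · rw [himg]
      exact hft

end Transversal

/-! ### Partitions, weights and Nebeský's condition -/

section Partition

open Finset
open scoped Classical

variable {V : Type*}

/-- `P` is a partition of `S` into nonempty parts. -/
structure IsPartitionOf (P : Finset (Finset V)) (S : Finset V) : Prop where
  nonempty : ∀ C ∈ P, C.Nonempty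
  eq_of_mem : ∀ C ∈ P, ∀ D ∈ P, ∀ v, v ∈ C → v ∈ D → C = D
  mem_iff : ∀ v, v ∈ S ↔ ∃ C ∈ P, v ∈ C

namespace IsPartitionOf

variable {P Q : Finset (Finset V)} {S T C : Finset V}

lemma subset (h : IsPartitionOf P S) (hC : C ∈ P) : C ⊆ S :=
  fun v hv => (h.mem_iff v).2 ⟨C, hC, hv⟩

lemma singleton (hS : S.Nonempty) : IsPartitionOf {S} S where
  nonempty := by simpa
  eq_of_mem := by simp
  mem_iff := by simp

lemma disjoint_parts (hP : IsPartitionOf P S) (hQ : IsPartitionOf Q T) (hST : Disjoint S T) :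
    Disjoint P Q := by
  rw [disjoint_left]
  intro C hCP hCQ
  obtain ⟨v, hv⟩ := hP.nonempty C hCP
  exact disjoint_left.1 hST (hP.subset hCP hv) (hQ.subset hCQ hv)

lemma union (hP : IsPartitionOf P S) (hQ : IsPartitionOf Q T) (hST : Disjoint S T) :
    IsPartitionOf (P ∪ Q) (S ∪ T) where
  nonempty C hC := (mem_union.1 hC).elim (hP.nonempty C) (hQ.nonempty C)
  eq_of_mem C hC D hD v hvC hvD := by
    rcases mem_union.1 hC with hC | hC <;> rcases mem_union.1 hD with hD | hD
    · exact hP.eq_of_mem C hC D hD v hvC hvD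
    · exact (disjoint_left.1 hST (hP.subset hC hvC) (hQ.subset hD hvD)).elim
    · exact (disjoint_left.1 hST (hP.subset hD hvD) (hQ.subset hC hvC)).elim
    · exact hQ.eq_of_mem C hC D hD v hvC hvD
  mem_iff v := by
    simp only [mem_union, hP.mem_iff, hQ.mem_iff, or_and_right, exists_or]

lemma biUnion_subset (hP : IsPartitionOf P S) (hQ : Q ⊆ P) : Q.biUnion id ⊆ S :=
  Finset.biUnion_subset.2 fun _ hC => hP.subset (hQ hC)

lemma biUnion_eq (hP : IsPartitionOf P S) : P.biUnion id = S := by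
  ext v
  simp [hP.mem_iff]

lemma sdiff (hP : IsPartitionOf P S) (hQ : Q ⊆ P) :
    IsPartitionOf (P \ Q) (S \ Q.biUnion id) where
  nonempty C hC := hP.nonempty C (mem_sdiff.1 hC).1
  eq_of_mem C hC D hD := hP.eq_of_mem C (mem_sdiff.1 hC).1 D (mem_sdiff.1 hD).1
  mem_iff v := by
    simp only [mem_sdiff, hP.mem_iff, mem_biUnion, id, not_exists, not_and]
    constructor
    · rintro ⟨⟨C, hC, hv⟩, h⟩
      exact ⟨C, ⟨hC, fun hCQ => h C hCQ hv⟩, hv⟩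
    · rintro ⟨C, ⟨hC, hCQ⟩, hv⟩
      refine ⟨⟨C, hC, hv⟩, fun D hD hvD => hCQ ?_⟩
      rwa [hP.eq_of_mem C hC D (hQ hD) v hv hvD]

lemma sum_card (hP : IsPartitionOf P S) : ∑ C ∈ P, #C = #S := by
  rw [← hP.biUnion_eq, card_biUnion]
  · rfl
  · intro C hC D hD hCD
    refine disjoint_left.2 ?_
    exact fun v hvC hvD => hCD (hP.eq_of_mem C hC D hD v hvC hvD)

lemma discrete (S : Finset V) : IsPartitionOf (S.image fun v => {v}) S where
  nonempty := by simp
  eq_of_mem := by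
    simp only [mem_image]
    rintro _ ⟨a, -, rfl⟩ _ ⟨b, -, rfl⟩ v hv hv'
    rw [mem_singleton] at hv hv'
    rw [← hv, ← hv']
  mem_iff := by simp

end IsPartitionOf

variable [Fintype V] (G : SimpleGraph V)

/-- `U` induces a subgraph for which `|E| - |U|` is even; if that subgraph is connected, then this
says that its Betti number is odd. -/
def IsOddPart (U : Finset V) : Prop := Even (#(edgesWithin G U) + #U)

/-- The number of edges within `U`, plus `1` or `2` according to the parity of the Betti number. -/
noncomputable def weight (U : Finset V) : ℕ :=
  #(edgesWithin G U) + 1 + if IsOddPart G U then 1 else 0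

/-- The condition in Nebeský's characterisation of upper-embeddable graphs, for the subgraph
induced by `S` under the assumption that its Betti number is even. -/
def IsBalanced (S : Finset V) : Prop :=
  ∀ P, IsPartitionOf P S → ∑ C ∈ P, weight G C ≤ #(edgesWithin G S) + 1

variable {G}

/-- The weight is `#(edgesWithin G U) + 1` rounded up to the parity of `#U`. Hence all partitions of
a set have total weights of the same parity, and one that is not tight misses the bound by at least
two. -/
lemma weight_mod_two (U : Finset V) : weight G U % 2 = #U % 2 := by
  rw [weight, IsOddPart]
  split_ifs with h <;> rw [Nat.even_iff] at h <;> omega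

lemma sum_weight_mod_two {P : Finset (Finset V)} {S : Finset V} (hP : IsPartitionOf P S) :
    (∑ C ∈ P, weight G C) % 2 = #S % 2 := by
  rw [← hP.sum_card, sum_nat_mod, sum_nat_mod P 2 card]
  simp only [weight_mod_two]

lemma card_edgesWithin_lt_weight (U : Finset V) : #(edgesWithin G U) + 1 ≤ weight G U := by
  rw [weight]
  omega

lemma edgesWithin_singleton (v : V) : edgesWithin G {v} = ∅ := by
  ext x
  induction x with | _ a b => ?_
  simp only [mk_mem_edgesWithin, mem_singleton, notMem_empty, iff_false]
  rintro ⟨h, rfl, rfl⟩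
  exact h.ne rfl

lemma weight_singleton (v : V) : weight G {v} = 1 := by
  simp [weight, IsOddPart, edgesWithin_singleton]

lemma IsBalanced.weight_eq {S : Finset V} (h : IsBalanced G S) (hS : S.Nonempty) :
    weight G S = #(edgesWithin G S) + 1 := by
  have := h {S} (IsPartitionOf.singleton hS)
  rw [sum_singleton] at this
  exact this.antisymm (card_edgesWithin_lt_weight S)

lemma IsBalanced.mod_two {S : Finset V} (h : IsBalanced G S) (hS : S.Nonempty) :
    (#(edgesWithin G S) + 1) % 2 = #S % 2 := by
  rw [← h.weight_eq hS, weight_mod_two]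

/-- Adding a singleton to a partition of the other vertices. -/
lemma sum_weight_insert_erase {S : Finset V} {v : V} (hv : v ∈ S) {Q : Finset (Finset V)}
    (hQ : IsPartitionOf Q (S.erase v)) :
    IsPartitionOf (Q ∪ {{v}}) S ∧ ∑ C ∈ Q ∪ {{v}}, weight G C = ∑ C ∈ Q, weight G C + 1 ∧
      #(Q ∪ {{v}}) = #Q + 1 := by
  have hv' := IsPartitionOf.singleton (singleton_nonempty v)
  have hd : Disjoint (S.erase v) {v} := by simp
  have h := hQ.union hv' hd
  have hd' := hQ.disjoint_parts hv' hd
  refine ⟨?_, ?_, ?_⟩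
  · convert h using 1
    ext w
    by_cases hw : w = v <;> simp [hw, hv]
  · rw [sum_union hd', sum_singleton, weight_singleton]
  · rw [card_union_of_disjoint hd', card_singleton]

/-- The passage to the multigraph whose nodes are the parts and whose edges are those between
different parts. -/
lemma card_edgesWithin_biUnion {P : Finset (Finset V)} {S : Finset V} (hP : IsPartitionOf P S)
    (ends : Sym2 V → Finset (Finset V)) (hends : ∀ x, ends x = {C ∈ P | ∃ v ∈ x, v ∈ C})
    {T : Finset (Finset V)} (hT : T ⊆ P) :
    #(edgesWithin G (T.biUnion id)) = ∑ C ∈ T, #(edgesWithin G C) +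
      spanned ends (edgesWithin G S \ P.biUnion (edgesWithin G)) T := by
  have hdisj : (T : Set (Finset V)).PairwiseDisjoint (edgesWithin G) := by
    intro C hC D hD hCD
    simp only [Function.onFun, disjoint_left]
    intro x
    induction x with | _ a b => ?_
    simp only [mk_mem_edgesWithin]
    exact fun h₁ h₂ => hCD (hP.eq_of_mem C (hT hC) D (hT hD) a h₁.2.1 h₂.2.1)
  rw [← card_biUnion hdisj, spanned, ← card_union_of_disjoint]
  · congr 1
    ext x
    induction x with | _ a b => ?_
    simp only [mem_union, mem_biUnion, mk_mem_edgesWithin, mem_filter, mem_sdiff, hends,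
      subset_iff, id, Sym2.mem_iff]
    constructor
    · rintro ⟨h, ⟨C, hC, haC⟩, ⟨D, hD, hbD⟩⟩
      by_cases hCD : C = D
      · exact Or.inl ⟨C, hC, h, haC, hCD ▸ hbD⟩
      · refine Or.inr ⟨⟨⟨h, hP.subset (hT hC) haC, hP.subset (hT hD) hbD⟩, ?_⟩, ?_⟩
        · rintro ⟨F, hF, -, haF, hbF⟩
          exact hCD ((hP.eq_of_mem C (hT hC) F hF a haC haF).trans
            (hP.eq_of_mem F hF D (hT hD) b hbF hbD))
        · rintro F ⟨hF, v, rfl | rfl, hvF⟩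
          · rwa [hP.eq_of_mem F hF C (hT hC) v hvF haC]
          · rwa [hP.eq_of_mem F hF D (hT hD) v hvF hbD]
    · rintro (⟨C, hC, h, ha, hb⟩ | ⟨⟨⟨h, ha, hb⟩, -⟩, hx⟩)
      · exact ⟨h, ⟨C, hC, ha⟩, ⟨C, hC, hb⟩⟩
      · obtain ⟨C, hC, haC⟩ := (hP.mem_iff a).1 ha
        obtain ⟨D, hD, hbD⟩ := (hP.mem_iff b).1 hb
        exact ⟨h, ⟨C, hx ⟨hC, a, Or.inl rfl, haC⟩, haC⟩, ⟨D, hx ⟨hD, b, Or.inr rfl, hbD⟩, hbD⟩⟩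
  · rw [disjoint_left]
    intro x hx hx'
    exact (mem_sdiff.1 (mem_filter.1 hx').1).2 (biUnion_subset_biUnion_of_subset_left _ hT hx)

/-- A nonempty balanced set induces a connected subgraph. -/
lemma IsBalanced.isLinked {S : Finset V} (h : IsBalanced G S) (hS : S.Nonempty) :
    IsLinked G S := by
  refine ⟨hS, fun W hW hWn hWS => ?_⟩
  by_contra! hno
  have hd : Disjoint W (S \ W) := disjoint_sdiff
  have hn : (S \ W).Nonempty := by
    rw [sdiff_nonempty]
    exact fun h' => hWS (hW.antisymm h')
  have h₁ := IsPartitionOf.singleton hWn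
  have h₂ := IsPartitionOf.singleton hn
  have h₃ := h₁.union h₂ hd
  rw [union_sdiff_of_subset hW] at h₃
  have h₄ := h _ h₃
  rw [sum_union (h₁.disjoint_parts h₂ hd), sum_singleton, sum_singleton] at h₄
  have h₅ : edgesWithin G S ⊆ edgesWithin G W ∪ edgesWithin G (S \ W) := by
    intro x
    induction x with | _ a b => ?_
    simp only [mem_union, mk_mem_edgesWithin, mem_sdiff]
    -- Without edges between `W` and `S \ W`, these two parts together weigh at least `#(edgesWithin
    -- G S) + 2`.
    rintro ⟨hab, ha, hb⟩
    by_cases ha' : a ∈ W <;> by_cases hb' : b ∈ W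
    · exact Or.inl ⟨hab, ha', hb'⟩
    · exact (hno a ha' b (mem_sdiff.2 ⟨hb, hb'⟩) hab).elim
    · exact (hno b hb' a (mem_sdiff.2 ⟨ha, ha'⟩) hab.symm).elim
    · exact Or.inr ⟨hab, ⟨ha, ha'⟩, hb, hb'⟩
  have h₆ := (card_le_card h₅).trans (card_union_le _ _)
  have h₇ := card_edgesWithin_lt_weight (G := G) W
  have h₈ := card_edgesWithin_lt_weight (G := G) (S \ W)
  omega

end Partition

/-! ### Nebeský's theorem for maximum degree three -/

section TreeComplement

open Finset
open scoped Classical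

variable {V : Type*} [Fintype V] {G : SimpleGraph V}

/-- `J` is an independent set of vertices of degree `3` of the subgraph induced by `S`, the removal
of which leaves a tree. -/
structure IsTreeComplement (G : SimpleGraph V) (S J : Finset V) : Prop where
  subset : J ⊆ S
  degree_eq : ∀ v ∈ J, degreeWithin G S v = 3
  not_adj : ∀ u ∈ J, ∀ v ∈ J, ¬ G.Adj u v
  isLinked : IsLinked G (S \ J)
  card_eq : #(edgesWithin G S) + 1 = #S + 2 * #J

lemma degreeWithin_erase {S : Finset V} {u v : V} (hv : v ∈ S) :
    degreeWithin G S u = degreeWithin G (S.erase v) u + if G.Adj u v then 1 else 0 := by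
  have h := degreeWithin_insert (G := G) (notMem_erase v S) u
  rwa [insert_erase hv] at h

/-- A partition of `S.erase v` becomes one of `S` by adding the part `{v}`, of weight 1, and erasing
`v` costs `degreeWithin G S v` edges. -/
lemma isBalanced_erase {S : Finset V} {v : V} (hv : v ∈ S) (hS : (S.erase v).Nonempty)
    (h : ∀ P, IsPartitionOf P S → 2 ≤ #P →
      ∑ C ∈ P, weight G C + degreeWithin G S v ≤ #(edgesWithin G S) + 2) :
    IsBalanced G (S.erase v) := by
  intro Q hQ
  obtain ⟨h₁, h₂, h₃⟩ := sum_weight_insert_erase (G := G) hv hQ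
  have h₄ : 0 < #Q := by
    obtain ⟨u, hu⟩ := hS
    obtain ⟨C, hC, -⟩ := (hQ.mem_iff u).1 hu
    exact card_pos.2 ⟨C, hC⟩
  have h₅ := h _ h₁ (by omega)
  have h₆ := card_edgesWithin_erase (G := G) hv
  omega

/-- Vertices of `J` already have degree 3 without `v`, so the degree bound forbids an edge from them
to `v`. The degree of `v` is left open, since it is 2 within an odd part. -/
lemma IsTreeComplement.of_erase {S J : Finset V} {v : V} (hv : v ∈ S)
    (hmax : ∀ u ∈ S, degreeWithin G S u ≤ 3) (h : IsTreeComplement G (S.erase v) J) :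
    v ∉ J ∧ insert v J ⊆ S ∧ (∀ u ∈ J, degreeWithin G S u = 3) ∧
      (∀ a ∈ insert v J, ∀ b ∈ insert v J, ¬ G.Adj a b) ∧ IsLinked G (S \ insert v J) := by
  have hvJ : v ∉ J := fun h' => notMem_erase v S (h.subset h')
  have hadj : ∀ u ∈ J, degreeWithin G S u = 3 ∧ ¬ G.Adj u v := by
    intro u hu
    have h₁ := degreeWithin_erase (G := G) (u := u) hv
    have h₂ := hmax u (mem_of_mem_erase (h.subset hu))
    have h₃ := h.degree_eq u hu
    split_ifs at h₁ with h₄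
    · omega
    · exact ⟨by omega, h₄⟩
  refine ⟨hvJ, insert_subset hv (h.subset.trans (erase_subset _ _)), fun u hu => (hadj u hu).1,
    ?_, ?_⟩
  · intro a ha b hb
    rcases mem_insert.1 ha with ha' | ha' <;> rcases mem_insert.1 hb with hb' | hb'
    · rw [ha', hb']
      exact G.irrefl
    · rw [ha']
      exact fun h' => (hadj b hb').2 h'.symm
    · rw [hb']
      exact (hadj a ha').2
    · exact h.not_adj a ha' b hb'
  · have : S \ insert v J = S.erase v \ J := by
      ext u
      simp only [mem_sdiff, mem_insert, mem_erase]
      tauto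
    rw [this]
    exact h.isLinked

/-- Refining a part of a partition. -/
lemma sum_weight_refine {P Q : Finset (Finset V)} {S C : Finset V} (hP : IsPartitionOf P S)
    (hC : C ∈ P) (hQ : IsPartitionOf Q C) :
    IsPartitionOf (P \ {C} ∪ Q) S ∧
      ∑ D ∈ P \ {C} ∪ Q, weight G D + weight G C = ∑ D ∈ P, weight G D + ∑ D ∈ Q, weight G D ∧
      #(P \ {C} ∪ Q) + 1 = #P + #Q := by
  have h₁ := hP.sdiff (singleton_subset_iff.2 hC)
  rw [singleton_biUnion, id] at h₁
  have hd : Disjoint (S \ C) C := sdiff_disjoint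
  have h₂ := h₁.union hQ hd
  rw [sdiff_union_of_subset (hP.subset hC)] at h₂
  have hd' := h₁.disjoint_parts hQ hd
  refine ⟨h₂, ?_, ?_⟩
  · rw [sum_union hd', ← sum_sdiff (singleton_subset_iff.2 hC), sum_singleton]
    ring
  · rw [card_union_of_disjoint hd', ← card_sdiff_add_card_eq_card (singleton_subset_iff.2 hC),
      card_singleton]
    ring

/-- Merging the parts in `T` gives another partition of `S`, which cannot outweigh the tight one. -/
lemma sum_weight_merge_le {P : Finset (Finset V)} {S : Finset V} (hS : IsBalanced G S)
    (hP : IsPartitionOf P S) (htight : ∑ C ∈ P, weight G C = #(edgesWithin G S) + 1)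
    {T : Finset (Finset V)} (hT : T ⊆ P) (hTn : T.Nonempty) :
    weight G (T.biUnion id) ≤ ∑ C ∈ T, weight G C := by
  have h₁ := hP.sdiff hT
  have hn : (T.biUnion id).Nonempty := by
    obtain ⟨C, hC⟩ := hTn
    obtain ⟨v, hv⟩ := hP.nonempty C (hT hC)
    exact ⟨v, mem_biUnion.2 ⟨C, hC, hv⟩⟩
  have h₂ := IsPartitionOf.singleton hn
  have hd : Disjoint (S \ T.biUnion id) (T.biUnion id) := sdiff_disjoint
  have h₃ := h₁.union h₂ hd
  rw [sdiff_union_of_subset (hP.biUnion_subset hT)] at h₃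
  have h₄ := hS _ h₃
  rw [sum_union (h₁.disjoint_parts h₂ hd), sum_singleton, ← htight, ← sum_sdiff hT] at h₄
  omega

/-- The gluing step: solutions inside the parts of a tight partition, which at an odd part use
exactly one of the edges leaving that part, combine to a solution. -/
lemma exists_isTreeComplement_of_parts {S : Finset V} {P : Finset (Finset V)}
    (hdeg : ∀ v ∈ S, degreeWithin G S v ≤ 3) (hP : IsPartitionOf P S)
    (htight : ∑ C ∈ P, weight G C = #(edgesWithin G S) + 1)
    (ends : Sym2 V → Finset (Finset V)) (hends : ∀ x, ends x = {C ∈ P | ∃ v ∈ x, v ∈ C})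
    (f : Finset V → Sym2 V) (hf : Set.InjOn f {C ∈ P | IsOddPart G C})
    (hfX : ∀ C ∈ P, IsOddPart G C → f C ∈ edgesWithin G S \ P.biUnion (edgesWithin G))
    (hsparse : ∀ T ⊆ P, T.Nonempty → spanned ends
      ((edgesWithin G S \ P.biUnion (edgesWithin G)) \ {C ∈ P | IsOddPart G C}.image f) T + 1 ≤ #T)
    (hcount : spanned ends
      ((edgesWithin G S \ P.biUnion (edgesWithin G)) \ {C ∈ P | IsOddPart G C}.image f) P + 1 = #P)
    (K : Finset V → Finset V) (hKsub : ∀ C ∈ P, K C ⊆ C)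
    (hKlink : ∀ C ∈ P, IsLinked G (C \ K C))
    (hKcard : ∀ C ∈ P, weight G C = #C + 2 * #(K C))
    (hKadj : ∀ C ∈ P, ∀ u ∈ K C, ∀ v ∈ K C, ¬ G.Adj u v)
    (hKdeg : ∀ C ∈ P, ∀ v ∈ K C, degreeWithin G C v = 3 ∨
      (IsOddPart G C ∧ v ∈ f C ∧ degreeWithin G C v = 2)) :
    IsTreeComplement G S (P.biUnion K) := by
  set X := edgesWithin G S \ P.biUnion (edgesWithin G) with hX
  have hJ : ∀ C ∈ P, ∀ v ∈ C, (v ∈ P.biUnion K ↔ v ∈ K C) := by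
    intro C hC v hv
    rw [mem_biUnion]
    refine ⟨fun ⟨D, hD, hvD⟩ => ?_, fun h => ⟨C, hC, h⟩⟩
    rwa [hP.eq_of_mem C hC D hD v hv (hKsub D hD hvD)]
  -- A removed vertex has an edge out of its part only if it is the end of `f C`, and then, by the
  -- degree bound, `f C` is its only such edge.
  have hout : ∀ C ∈ P, ∀ v ∈ K C, ∀ u ∈ S, u ∉ C → G.Adj v u →
      degreeWithin G C v = 2 ∧ IsOddPart G C ∧ f C = s(v, u) := by
    intro C hC v hv u hu huC hvu
    have hCS := hP.subset hC
    have hvC := hKsub C hC hv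
    have h₀ := hdeg v (hCS hvC)
    have h₁ : degreeWithin G (insert u C) v ≤ degreeWithin G S v :=
      degreeWithin_mono (insert_subset hu hCS) v
    rw [degreeWithin_insert huC, if_pos hvu] at h₁
    rcases hKdeg C hC v hv with h₂ | ⟨hodd, hvf, h₂⟩
    · omega
    · refine ⟨h₂, hodd, ?_⟩
      have h₃ := hfX C hC hodd
      induction hfC : f C with | _ a b => ?_
      obtain ⟨w, hw⟩ := Sym2.mem_iff_exists.1 hvf
      rw [← hfC, hw]
      rw [hw, hX, mem_sdiff, mk_mem_edgesWithin] at h₃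
      by_contra hne
      have huw : w ≠ u := fun h => hne (by rw [h])
      have hwC : w ∉ C := fun h => h₃.2 (mem_biUnion.2
        ⟨C, hC, mk_mem_edgesWithin.2 ⟨h₃.1.1, hvC, h⟩⟩)
      have h₄ : degreeWithin G (insert w (insert u C)) v ≤ degreeWithin G S v :=
        degreeWithin_mono (insert_subset h₃.1.2.2 (insert_subset hu hCS)) v
      rw [degreeWithin_insert (by simp [huw, hwC]), degreeWithin_insert huC, if_pos hvu,
        if_pos h₃.1.1] at h₄
      omega
  refine ⟨?_, ?_, ?_, ⟨?_, ?_⟩, ?_⟩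
  · exact biUnion_subset.2 fun C hC => (hKsub C hC).trans (hP.subset hC)
  · intro v hv
    obtain ⟨C, hC, hv⟩ := mem_biUnion.1 hv
    have hvC := hKsub C hC hv
    have h₀ := hdeg v (hP.subset hC hvC)
    have h₁ := degreeWithin_mono (G := G) (hP.subset hC) v
    rcases hKdeg C hC v hv with h₂ | ⟨hodd, hvf, h₂⟩
    · omega
    · have h₃ := hfX C hC hodd
      obtain ⟨w, hw⟩ := Sym2.mem_iff_exists.1 hvf
      rw [hw, hX, mem_sdiff, mk_mem_edgesWithin] at h₃
      have hwC : w ∉ C := fun h => h₃.2 (mem_biUnion.2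
        ⟨C, hC, mk_mem_edgesWithin.2 ⟨h₃.1.1, hvC, h⟩⟩)
      have h₄ : degreeWithin G (insert w C) v ≤ degreeWithin G S v :=
        degreeWithin_mono (insert_subset h₃.1.2.2 (hP.subset hC)) v
      rw [degreeWithin_insert hwC, if_pos h₃.1.1] at h₄
      omega
  · intro u hu v hv huv
    obtain ⟨C, hC, hu⟩ := mem_biUnion.1 hu
    obtain ⟨D, hD, hv⟩ := mem_biUnion.1 hv
    have huC := hKsub C hC hu
    have hvD := hKsub D hD hv
    by_cases hCD : C = D
    · subst hCD
      exact hKadj C hC u hu v hv huv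
    · have h₁ := hout C hC u hu v (hP.subset hD hvD)
        (fun h => hCD (hP.eq_of_mem C hC D hD v h hvD)) huv
      have h₂ := hout D hD v hv u (hP.subset hC huC)
        (fun h => hCD (hP.eq_of_mem C hC D hD u huC h)) huv.symm
      exact hCD (hf (by simp [hC, h₁.2.1]) (by simp [hD, h₂.2.1])
        (h₁.2.2.trans (Sym2.eq_swap.trans h₂.2.2.symm)))
  · have hPn : P.Nonempty := card_pos.1 (by omega)
    obtain ⟨C, hC⟩ := hPn
    obtain ⟨v, hv⟩ := (hKlink C hC).1
    rw [mem_sdiff] at hv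
    exact ⟨v, mem_sdiff.2 ⟨hP.subset hC hv.1, fun h => hv.2 ((hJ C hC v hv.1).1 h)⟩⟩
  · intro W hW hWn hWS
    by_contra! hno
    -- Each `C \ K C` is linked, so `W` contains all of it or none of it.
    have hall : ∀ C ∈ P, ∀ a ∈ C, ∀ b ∈ C, a ∈ W → b ∉ W → b ∉ P.biUnion K → False := by
      intro C hC a ha b hb haW hbW hbJ
      have haJ := (mem_sdiff.1 (hW haW)).2
      rw [hJ C hC a ha] at haJ
      rw [hJ C hC b hb] at hbJ
      obtain ⟨c, hc, d, hd, hcd⟩ := (hKlink C hC).2 ((C \ K C) ∩ W) inter_subset_left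
        ⟨a, by simp [ha, haW, haJ]⟩
        (fun h => hbW (mem_inter.1 (h.symm ▸ (mem_sdiff.2 ⟨hb, hbJ⟩ : b ∈ C \ K C))).2)
      simp only [mem_inter, mem_sdiff, not_and] at hc hd
      refine hno c hc.2 d (mem_sdiff.2 ⟨mem_sdiff.2 ⟨hP.subset hC hd.1.1, ?_⟩, hd.2 hd.1⟩) hcd
      rw [hJ C hC d hd.1.1]
      exact hd.1.2
    set T : Finset (Finset V) := {C ∈ P | ∃ a ∈ C, a ∈ W} with hT
    set T' := P \ T with hT'
    have hTP : T ⊆ P := filter_subset _ _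
    have hTn : T.Nonempty := by
      obtain ⟨a, ha⟩ := hWn
      obtain ⟨C, hC, haC⟩ := (hP.mem_iff a).1 (mem_sdiff.1 (hW ha)).1
      exact ⟨C, by simp only [hT, mem_filter]; exact ⟨hC, a, haC, ha⟩⟩
    have hTn' : T'.Nonempty := by
      obtain ⟨b, hb, hbW⟩ : ∃ b ∈ S \ P.biUnion K, b ∉ W := by
        by_contra! h
        exact hWS (hW.antisymm h)
      rw [mem_sdiff] at hb
      obtain ⟨C, hC, hbC⟩ := (hP.mem_iff b).1 hb.1
      refine ⟨C, mem_sdiff.2 ⟨hC, fun h => ?_⟩⟩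
      obtain ⟨a, haC, ha⟩ := (mem_filter.1 h).2
      exact hall C hC a haC b hbC ha hbW hb.2
    have h₁ := hsparse T hTP hTn
    have h₂ := hsparse T' sdiff_subset hTn'
    have h₃ : #T' + #T = #P := card_sdiff_add_card_eq_card hTP
    set Y := X \ {C ∈ P | IsOddPart G C}.image f with hY
    -- By sparsity `T` and `T'` span at most `#P - 2` edges of `Y` together, but `Y` has `#P - 1`
    -- edges on `P`.
    have hcross : ∃ y ∈ Y, ¬ ends y ⊆ T ∧ ¬ ends y ⊆ T' := by
      by_contra! h
      have : spanned ends Y P ≤ spanned ends Y T + spanned ends Y T' := by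
        rw [spanned, spanned, spanned]
        refine (card_le_card ?_).trans (card_union_le _ _)
        intro y hy
        rw [mem_filter] at hy
        rw [mem_union, mem_filter, mem_filter]
        by_cases hyT : ends y ⊆ T
        · exact Or.inl ⟨hy.1, hyT⟩
        · exact Or.inr ⟨hy.1, h y hy.1 hyT⟩
      omega
    obtain ⟨y, hyY, hyT, hyT'⟩ := hcross
    obtain ⟨D, hDy, hDT⟩ := not_subset.1 hyT
    obtain ⟨C, hCy, hCT⟩ := not_subset.1 hyT'
    rw [hends, mem_filter] at hDy hCy
    obtain ⟨hD, b, hby, hbD⟩ := hDy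
    obtain ⟨hC, a, hay, haC⟩ := hCy
    have hCT : C ∈ T := by
      by_contra h
      exact hCT (mem_sdiff.2 ⟨hC, h⟩)
    have hCD : C ≠ D := fun h => hDT (h ▸ hCT)
    have hab : a ≠ b := fun h => hCD (hP.eq_of_mem C hC D hD a haC (h ▸ hbD))
    have hy : y = s(a, b) := (Sym2.mem_and_mem_iff hab).1 ⟨hay, hby⟩
    subst hy
    rw [hY, mem_sdiff, hX, mem_sdiff, mk_mem_edgesWithin] at hyY
    obtain ⟨⟨⟨habG, haS, hbS⟩, -⟩, hyf⟩ := hyY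
    -- An edge kept in `Y` represents no part, so by `hout` its ends are not removed.
    have haJ : a ∉ P.biUnion K := by
      rw [hJ C hC a haC]
      intro h
      have := hout C hC a h b hbS (fun h => hCD (hP.eq_of_mem C hC D hD b h hbD)) habG
      exact hyf (mem_image.2 ⟨C, mem_filter.2 ⟨hC, this.2.1⟩, this.2.2⟩)
    have hbJ : b ∉ P.biUnion K := by
      rw [hJ D hD b hbD]
      intro h
      have := hout D hD b h a haS (fun h => hCD (hP.eq_of_mem C hC D hD a haC h)) habG.symm
      exact hyf (mem_image.2 ⟨D, mem_filter.2 ⟨hD, this.2.1⟩, this.2.2.trans Sym2.eq_swap⟩)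
    have haW : a ∈ W := by
      by_contra h
      obtain ⟨c, hcC, hcW⟩ := (mem_filter.1 hCT).2
      exact hall C hC c hcC a haC hcW h haJ
    have hbW : b ∉ W := fun h => hDT (mem_filter.2 ⟨hD, b, hbD, h⟩)
    exact hno a haW b (mem_sdiff.2 ⟨mem_sdiff.2 ⟨hbS, hbJ⟩, hbW⟩) habG
  · rw [← htight, sum_congr rfl hKcard, sum_add_distrib, hP.sum_card, ← mul_sum, card_biUnion]
    intro C hC D hD hCD
    refine disjoint_left.2 ?_
    exact fun v hvC hvD => hCD (hP.eq_of_mem C hC D hD v (hKsub C hC hvC) (hKsub D hD hvD))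

/-- A form of Nebeský's theorem on upper-embeddable graphs: a nonempty balanced set of vertices in
a graph of maximum degree at most `3` contains an independent set of vertices of degree `3` the
removal of which leaves a tree. -/
theorem IsBalanced.exists_isTreeComplement {S : Finset V} (hS : S.Nonempty)
    (hdeg : ∀ v ∈ S, degreeWithin G S v ≤ 3) (h : IsBalanced G S) :
    ∃ J, IsTreeComplement G S J := by
  induction hn : #S using Nat.strong_induction_on generalizing S with | _ n ih => ?_
  subst hn
  have hdegs : ∀ {C : Finset V}, C ⊆ S → ∀ v ∈ C, degreeWithin G C v ≤ 3 :=
    fun hC v hv => (degreeWithin_mono hC v).trans (hdeg v (hC hv))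
  let tights : Finset (Finset (Finset V)) :=
    {P | IsPartitionOf P S ∧ ∑ C ∈ P, weight G C = #(edgesWithin G S) + 1}
  have hmem : ∀ P, P ∈ tights ↔ IsPartitionOf P S ∧
      ∑ C ∈ P, weight G C = #(edgesWithin G S) + 1 := by simp [tights]
  obtain ⟨P, hP, hmax⟩ := exists_max_image tights card
    ⟨{S}, (hmem _).2 ⟨.singleton hS, by rw [sum_singleton, h.weight_eq hS]⟩⟩
  rw [hmem] at hP
  obtain ⟨hP, htight⟩ := hP
  have hpar := h.mod_two hS
  -- A partition with more parts than `P` is not tight, hence by parity two below the bound.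
  have hstrict : ∀ Q, IsPartitionOf Q S → #P < #Q →
      ∑ C ∈ Q, weight G C + 1 ≤ #(edgesWithin G S) := by
    intro Q hQ hlt
    have h₁ := h Q hQ
    have h₂ := sum_weight_mod_two (G := G) hQ
    have h₃ : ∑ C ∈ Q, weight G C ≠ #(edgesWithin G S) + 1 := fun h' =>
      absurd (hmax Q ((hmem Q).2 ⟨hQ, h'⟩)) (by omega)
    omega
  by_cases hP1 : #P ≤ 1
  · by_cases htree : #(edgesWithin G S) + 1 = #S
    · exact ⟨∅, empty_subset _, by simp, by simp, by simpa using h.isLinked hS, by simpa using htree⟩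
    · have hge : #S ≤ #(edgesWithin G S) + 1 := by
        have h₁ := h _ (IsPartitionOf.discrete S)
        rw [sum_image (by simp)] at h₁
        simpa [weight_singleton] using h₁
      -- If all degrees were at most 2, there would be at most `#S` edges; not being a tree then
      -- forces exactly `#S`, which has the wrong parity.
      obtain ⟨v, hv, hv3⟩ : ∃ v ∈ S, 3 ≤ degreeWithin G S v := by
        by_contra! hlt
        have h₁ := sum_degreeWithin (G := G) S
        have h₂ : ∑ v ∈ S, degreeWithin G S v ≤ ∑ _v ∈ S, 2 :=
          sum_le_sum fun v hv => Nat.le_of_lt_succ (hlt v hv)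
        rw [sum_const, smul_eq_mul] at h₂
        omega
      have hv3 : degreeWithin G S v = 3 := (hdeg v hv).antisymm hv3
      have hne : (S.erase v).Nonempty := by
        have : degreeWithin G (S.erase v) v = 3 := by
          rw [← hv3, degreeWithin_erase hv, if_neg G.irrefl, add_zero]
        obtain ⟨w, hw⟩ := card_pos.1 (show 0 < degreeWithin G (S.erase v) v by omega)
        exact ⟨w, (mem_filter.1 hw).1⟩
      have hb : IsBalanced G (S.erase v) := isBalanced_erase hv hne fun Q hQ h2 => by
        have := hstrict Q hQ (by omega)
        omega
      obtain ⟨J, hJ⟩ := ih _ (card_erase_lt_of_mem hv) hne (hdegs (erase_subset _ _)) hb rfl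
      obtain ⟨h₁, h₂, h₃, h₄, h₅⟩ := hJ.of_erase hv hdeg
      refine ⟨insert v J, h₂, ?_, h₄, h₅, ?_⟩
      · intro u hu
        rcases mem_insert.1 hu with rfl | hu
        · exact hv3
        · exact h₃ u hu
      · have h₆ := hJ.card_eq
        have h₇ := card_edgesWithin_erase (G := G) hv
        have h₉ := card_erase_add_one hv
        rw [card_insert_of_notMem h₁]
        omega
  · have hlt : ∀ C ∈ P, #C < #S := by
      intro C hC
      refine card_lt_card ((hP.subset hC).ssubset_of_ne ?_)
      rintro rfl
      refine hP1 (card_le_one.2 fun D hD D' hD' => ?_)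
      have : ∀ D ∈ P, D = C := by
        intro D hD
        obtain ⟨v, hv⟩ := hP.nonempty D hD
        exact hP.eq_of_mem D hD C hC v hv (hP.subset hD hv)
      rw [this D hD, this D' hD']
    let ends : Sym2 V → Finset (Finset V) := fun x => {C ∈ P | ∃ v ∈ x, v ∈ C}
    have hends : ∀ x, ends x = {C ∈ P | ∃ v ∈ x, v ∈ C} := fun _ => rfl
    set X := edgesWithin G S \ P.biUnion (edgesWithin G) with hX
    set O : Finset (Finset V) := {C ∈ P | IsOddPart G C} with hO
    have hOP : O ⊆ P := filter_subset _ _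
    have hwt : ∀ T ⊆ P, ∑ C ∈ T, weight G C = ∑ C ∈ T, #(edgesWithin G C) + #T + #(T ∩ O) := by
      intro T hT
      have : T ∩ O = {C ∈ T | IsOddPart G C} := by
        ext C
        simp only [hO, mem_inter, mem_filter]
        exact ⟨fun h => ⟨h.1, h.2.2⟩, fun h => ⟨h.1, hT h.1, h.2⟩⟩
      rw [this]
      simp [weight, sum_add_distrib]
    have : Nonempty (Sym2 V) := ⟨s(hS.choose, hS.choose)⟩
    obtain ⟨f, hf, hfX, hsparse, hcount⟩ := exists_transversal ends P O hOP X
      -- Sparsity is the merging inequality for `T`, with the edges inside the parts cancelled.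
      (fun T hT hTn => by
        have h₁ := sum_weight_merge_le h hP htight hT hTn
        have h₂ := card_edgesWithin_biUnion (G := G) hP ends hends hT
        rw [← hX] at h₂
        have h₃ := card_edgesWithin_lt_weight (G := G) (T.biUnion id)
        have h₄ := hwt T hT
        omega)
      (by
        have h₂ := card_edgesWithin_biUnion (G := G) hP ends hends subset_rfl
        have h₄ := hwt P subset_rfl
        rw [hP.biUnion_eq, ← hX] at h₂
        rw [inter_eq_right.2 hOP] at h₄
        omega)
      (fun x hx C hxC => by
        rw [hX, mem_sdiff] at hx
        refine hx.2 ?_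
        induction x with | _ a b => ?_
        have hx₁ := mk_mem_edgesWithin.1 hx.1
        obtain ⟨A, hA, ha⟩ := (hP.mem_iff a).1 hx₁.2.1
        obtain ⟨B, hB, hb⟩ := (hP.mem_iff b).1 hx₁.2.2
        have hAC := mem_singleton.1 (hxC (mem_filter.2 ⟨hA, a, Sym2.mem_mk_left a b, ha⟩))
        have hBC := mem_singleton.1 (hxC (mem_filter.2 ⟨hB, b, Sym2.mem_mk_right a b, hb⟩))
        subst hAC
        subst hBC
        exact mem_biUnion.2 ⟨B, hB, mk_mem_edgesWithin.2 ⟨hx₁.1, ha, hb⟩⟩)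
    have hpiece : ∀ C ∈ P, ∃ K ⊆ C, IsLinked G (C \ K) ∧ weight G C = #C + 2 * #K ∧
        (∀ u ∈ K, ∀ v ∈ K, ¬ G.Adj u v) ∧ ∀ v ∈ K, degreeWithin G C v = 3 ∨
          (IsOddPart G C ∧ v ∈ f C ∧ degreeWithin G C v = 2) := by
      intro C hC
      have hCn := hP.nonempty C hC
      have hCdeg := hdegs (hP.subset hC)
      by_cases hodd : IsOddPart G C
      · have hwC : weight G C = #(edgesWithin G C) + 2 := by rw [weight, if_pos hodd]
        -- Refining `P` inside `C` increases the number of parts, so `hstrict` applies and the total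
        -- is at most `weight G C - 2`.
        have hCstrict : ∀ Q, IsPartitionOf Q C → 2 ≤ #Q →
            ∑ D ∈ Q, weight G D ≤ #(edgesWithin G C) := by
          intro Q hQ hQ2
          obtain ⟨h₁, h₂, h₃⟩ := sum_weight_refine (G := G) hP hC hQ
          have h₄ := hstrict _ h₁ (by omega)
          have h₅ := sum_weight_mod_two (G := G) hQ
          have h₆ := weight_mod_two (G := G) C
          omega
        obtain ⟨hfC, hCf⟩ := hfX C (mem_filter.2 ⟨hC, hodd⟩)
        obtain ⟨-, w, hwf, hwC'⟩ := mem_filter.1 hCf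
        obtain ⟨u, hu⟩ := Sym2.mem_iff_exists.1 hwf
        rw [hu, hX, mem_sdiff, mk_mem_edgesWithin] at hfC
        have huC : u ∉ C := fun h' => hfC.2 (mem_biUnion.2
          ⟨C, hC, mk_mem_edgesWithin.2 ⟨hfC.1.1, hwC', h'⟩⟩)
        have hne : (C.erase w).Nonempty := by
          rw [nonempty_iff_ne_empty]
          intro h₀
          have : C = {w} := by
            rw [← insert_erase hwC', h₀]
            rfl
          rw [this, weight_singleton] at hwC
          omega
        -- At most 2 because `f C` leaves `C` at `w`; at least 2 by `hCstrict` for the partition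
        -- into `{w}` and `C.erase w`.
        have hwdeg : degreeWithin G C w = 2 := by
          have h₁ : degreeWithin G (insert u C) w ≤ degreeWithin G S w :=
            degreeWithin_mono (insert_subset hfC.1.2.2 (hP.subset hC)) w
          rw [degreeWithin_insert huC, if_pos hfC.1.1] at h₁
          have h₂ := hdeg w hfC.1.2.1
          obtain ⟨h₃, h₄, h₅⟩ := sum_weight_insert_erase (G := G) hwC'
            (IsPartitionOf.singleton hne)
          have h₆ := hCstrict _ h₃ (by rw [h₅, card_singleton])
          rw [h₄, sum_singleton] at h₆
          have h₇ := card_edgesWithin_lt_weight (G := G) (C.erase w)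
          have h₈ := card_edgesWithin_erase (G := G) hwC'
          omega
        have hb : IsBalanced G (C.erase w) := isBalanced_erase hwC' hne fun Q hQ hQ2 => by
          have := hCstrict Q hQ hQ2
          omega
        obtain ⟨J, hJ⟩ := ih _ ((card_erase_lt_of_mem hwC').trans (hlt C hC)) hne
          (hdegs ((erase_subset _ _).trans (hP.subset hC))) hb rfl
        obtain ⟨h₁, h₂, h₃, h₄, h₅⟩ := hJ.of_erase hwC' hCdeg
        refine ⟨insert w J, h₂, h₅, ?_, h₄, ?_⟩
        · have h₆ := hJ.card_eq
          have h₇ := card_edgesWithin_erase (G := G) hwC'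
          have h₉ := card_erase_add_one hwC'
          rw [card_insert_of_notMem h₁]
          omega
        · intro v hv
          rcases mem_insert.1 hv with rfl | hv
          · exact Or.inr ⟨hodd, hwf, hwdeg⟩
          · exact Or.inl (h₃ v hv)
      · have hwC : weight G C = #(edgesWithin G C) + 1 := by rw [weight, if_neg hodd]
        -- Refining `P` inside an even part cannot raise the total above the tight value.
        have hb : IsBalanced G C := by
          intro Q hQ
          obtain ⟨h₁, h₂, -⟩ := sum_weight_refine (G := G) hP hC hQ
          have h₃ := h _ h₁
          omega
        obtain ⟨J, hJ⟩ := ih _ (hlt C hC) hCn hCdeg hb rfl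
        exact ⟨J, hJ.subset, hJ.isLinked, hwC.trans hJ.card_eq, hJ.not_adj,
          fun v hv => Or.inl (hJ.degree_eq v hv)⟩
    choose! K hK₁ hK₂ hK₃ hK₄ hK₅ using hpiece
    exact ⟨P.biUnion K, exists_isTreeComplement_of_parts hdeg hP htight ends hends f
      (by simpa [hO] using hf) (fun C hC hodd => (hfX C (mem_filter.2 ⟨hC, hodd⟩)).1)
      hsparse hcount K hK₁ hK₂ hK₃ hK₄ hK₅⟩

end TreeComplement

/-! ### From odd sides to coherent decycling partitions -/

section CubicGraphs

open Finset
open scoped Classical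

variable {V : Type*} [Fintype V] {G : SimpleGraph V}

/-- Edge-connectivity: at least `k` edges leave every nonempty proper set of vertices. -/
def IsEdgeCutBounded (k : ℕ) (G : SimpleGraph V) : Prop :=
  ∀ S : Finset V, S.Nonempty → Sᶜ.Nonempty → k ≤ #(boundary G S)

/-- One side of a `3`-edge-cut which has `3` modulo `4` vertices. In a cubic graph these are the
sides with an odd Betti number. -/
def IsOddSide (G : SimpleGraph V) (S : Finset V) : Prop :=
  #(boundary G S) = 3 ∧ #S % 4 = 3

/-- There are no two disjoint odd sides of `3`-edge-cuts. -/
def HasNoDisjointOddSides (G : SimpleGraph V) : Prop :=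
  ∀ S T : Finset V, Disjoint S T → IsOddSide G S → ¬ IsOddSide G T

/-- With boundary size d, twice the weight is `3 * #C - d + 2`, plus 2 at an odd part. This exceeds
`3 * #C` only for d = 3 and an odd part, which then means `#C % 4 = 3`. -/
lemma two_mul_weight_le (hG : IsCubic G) (h3 : IsEdgeCutBounded 3 G) {C : Finset V}
    (hC : C.Nonempty) (hC' : Cᶜ.Nonempty) :
    2 * weight G C ≤ 3 * #C + if IsOddSide G C then 1 else 0 := by
  have h₁ := h3 C hC hC'
  have h₂ := two_mul_card_edgesWithin_add_card_boundary hG C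
  rw [weight, IsOddPart, IsOddSide, Nat.even_iff]
  split_ifs <;> omega

lemma two_mul_sum_weight_le (hG : IsCubic G) (h3 : IsEdgeCutBounded 3 G)
    (hodd : HasNoDisjointOddSides G) {S : Finset V} {P : Finset (Finset V)}
    (hP : IsPartitionOf P S) (hP' : ∀ C ∈ P, Cᶜ.Nonempty) :
    2 * ∑ C ∈ P, weight G C ≤ 3 * #S + 1 := by
  rw [mul_sum, ← hP.sum_card, mul_sum]
  refine (sum_le_sum fun C hC => two_mul_weight_le hG h3 (hP.nonempty C hC) (hP' C hC)).trans ?_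
  rw [sum_add_distrib, sum_boole, Nat.cast_id]
  refine add_le_add_right (card_le_one.2 fun C hC D hD => ?_) _
  rw [mem_filter] at hC hD
  by_contra hCD
  refine hodd C D (disjoint_left.2 fun v hvC hvD => ?_) hC.2 hD.2
  exact hCD (hP.eq_of_mem C hC.1 D hD.1 v hvC hvD)

lemma two_mul_card_edgesWithin_univ (hG : IsCubic G) :
    2 * #(edgesWithin G univ) = 3 * Fintype.card V := by
  have h := two_mul_card_edgesWithin_add_card_boundary hG univ
  have h' : boundary G univ = ∅ := by simp [boundary]
  simpa [h'] using h

lemma isBalanced_univ (hG : IsCubic G) (h3 : IsEdgeCutBounded 3 G)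
    (hodd : HasNoDisjointOddSides G) (hn : Fintype.card V % 4 = 2) : IsBalanced G univ := by
  intro P hP
  have he := two_mul_card_edgesWithin_univ hG
  by_cases huniv : univ ∈ P
  · have hP1 : P = {univ} := by
      refine eq_singleton_iff_unique_mem.2 ⟨huniv, fun D hD => ?_⟩
      obtain ⟨v, hv⟩ := hP.nonempty D hD
      exact hP.eq_of_mem D hD univ huniv v hv (mem_univ v)
    rw [hP1, sum_singleton, weight, if_neg]
    rw [IsOddPart, Nat.even_iff, card_univ]
    omega
  · have h := two_mul_sum_weight_le hG h3 hodd hP fun C hC => by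
      rw [nonempty_iff_ne_empty, Ne, compl_eq_empty_iff]
      exact fun h => huniv (h ▸ hC)
    rw [card_univ] at h
    omega

lemma degreeWithin_univ_eq (hG : IsCubic G) (v : V) : degreeWithin G univ v = 3 := by
  rw [degreeWithin_univ, hG v]

lemma card_edgesWithin_erase_erase (hG : IsCubic G) {u v : V} (huv : G.Adj u v) :
    #(edgesWithin G univ) = #(edgesWithin G ((univ.erase u).erase v)) + 5 := by
  have h₁ := card_edgesWithin_erase (G := G) (mem_univ u)
  have h₂ := card_edgesWithin_erase (G := G) (mem_erase.2 ⟨huv.ne', mem_univ v⟩)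
  have h₄ := degreeWithin_erase (G := G) (u := v) (mem_univ u)
  rw [degreeWithin_univ_eq hG] at h₁
  rw [degreeWithin_univ_eq hG, if_pos huv.symm] at h₄
  omega

/-- The weight estimate alone falls one short of the required bound; the parity of the total weight
supplies the difference. -/
lemma isBalanced_erase_erase (hG : IsCubic G) (h3 : IsEdgeCutBounded 3 G)
    (hodd : HasNoDisjointOddSides G) (hn : Fintype.card V % 4 = 0) {u v : V} (huv : G.Adj u v) :
    IsBalanced G ((univ.erase u).erase v) := by
  intro P hP
  have he := two_mul_card_edgesWithin_univ hG
  have he' := card_edgesWithin_erase_erase hG huv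
  have h := two_mul_sum_weight_le hG h3 hodd hP fun C hC =>
    ⟨v, mem_compl.2 fun hv => notMem_erase v _ (hP.subset hC hv)⟩
  have hpar := sum_weight_mod_two (G := G) hP
  have h₁ := card_erase_add_one (mem_erase.2 ⟨huv.ne', mem_univ v⟩)
  have h₂ := card_erase_add_one (mem_univ u)
  rw [card_univ] at h₂
  omega

lemma IsTreeComplement.card_edgesWithin_sdiff {S J : Finset V} (h : IsTreeComplement G S J) :
    #(edgesWithin G (S \ J)) + 1 = #(S \ J) := by
  -- As `J` is independent, its vertices keep degree 3 while they are removed one by one.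
  have key : ∀ K ⊆ J, #(edgesWithin G S) = #(edgesWithin G (S \ K)) + 3 * #K := by
    intro K hK
    induction K using Finset.induction_on with
    | empty => simp
    | insert v K hv ih =>
      have hvJ := hK (mem_insert_self v K)
      have hKJ := (subset_insert v K).trans hK
      have h₁ := card_edgesWithin_erase (G := G) (mem_sdiff.2 ⟨h.subset hvJ, hv⟩)
      have h₂ : degreeWithin G (S \ K) v = 3 := by
        rw [← h.degree_eq v hvJ, degreeWithin, degreeWithin]
        congr 1
        ext w
        simp only [mem_filter, mem_sdiff]
        exact ⟨fun h' => ⟨h'.1.1, h'.2⟩,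
          fun h' => ⟨⟨h'.1, fun hw => h.not_adj v hvJ w (hKJ hw) h'.2⟩, h'.2⟩⟩
      have h₃ : S \ insert v K = (S \ K).erase v := by
        ext w
        simp only [mem_sdiff, mem_insert, mem_erase]
        tauto
      rw [ih hKJ, h₁, h₂, h₃, card_insert_of_notMem hv]
      ring
  have h₁ := key J subset_rfl
  have h₂ := h.card_eq
  have h₃ := card_sdiff_add_card_eq_card h.subset
  omega

/-- The combinatorial core: a set of vertices inducing at most one edge, the removal of which leaves
a tree. -/
theorem exists_tree_complement [Nonempty V] (hG : IsCubic G) (h3 : IsEdgeCutBounded 3 G)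
    (hodd : HasNoDisjointOddSides G) :
    ∃ J : Finset V, #(edgesWithin G J) ≤ 1 ∧ IsLinked G Jᶜ ∧
      #(edgesWithin G Jᶜ) + 1 = #Jᶜ ∧ 4 * #J ≤ Fintype.card V + 4 := by
  have he := two_mul_card_edgesWithin_univ hG
  have hdeg : ∀ S : Finset V, ∀ v ∈ S, degreeWithin G S v ≤ 3 := fun S v _ => by
    rw [← degreeWithin_univ_eq hG v]
    exact degreeWithin_mono (subset_univ S) v
  have hn : Fintype.card V % 4 = 2 ∨ Fintype.card V % 4 = 0 := by omega
  rcases hn with hn | hn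
  · obtain ⟨J, hJ⟩ := (isBalanced_univ hG h3 hodd hn).exists_isTreeComplement univ_nonempty
      (hdeg univ)
    have h₁ := hJ.isLinked
    have h₂ := hJ.card_edgesWithin_sdiff
    have h₃ := hJ.card_eq
    rw [← compl_eq_univ_sdiff] at h₁ h₂
    rw [card_univ] at h₃
    refine ⟨J, ?_, h₁, h₂, by omega⟩
    refine (card_eq_zero.2 ?_).trans_le zero_le_one
    ext x
    induction x with | _ a b => ?_
    simp only [mk_mem_edgesWithin, notMem_empty, iff_false]
    exact fun h => hJ.not_adj a h.2.1 b h.2.2 h.1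
  · obtain ⟨u⟩ := ‹Nonempty V›
    obtain ⟨v, hv⟩ := card_pos.1 (show 0 < degreeWithin G univ u by
      rw [degreeWithin_univ_eq hG]; omega)
    have huv : G.Adj u v := (mem_filter.1 hv).2
    set S := (univ.erase u).erase v with hS
    have h₁ := card_erase_add_one (mem_erase.2 ⟨huv.ne', mem_univ v⟩)
    have h₂ := card_erase_add_one (mem_univ u)
    have h₃ : 0 < Fintype.card V := Fintype.card_pos_iff.2 ⟨u⟩
    rw [card_univ] at h₂
    rw [← hS] at h₁
    obtain ⟨J, hJ⟩ := (isBalanced_erase_erase hG h3 hodd hn huv).exists_isTreeComplement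
      (card_pos.1 (by omega)) (hdeg S)
    have he' := card_edgesWithin_erase_erase hG huv
    rw [← hS] at he'
    have hcompl : (insert u (insert v J))ᶜ = S \ J := by
      ext w
      simp only [hS, mem_compl, mem_insert, mem_sdiff, mem_erase, mem_univ]
      tauto
    have hu : u ∉ S := by simp [hS]
    have hv : v ∉ S := by simp [hS]
    -- Vertices of `J` have all three neighbours inside `S`, so they are adjacent to neither `u` nor
    -- `v`.
    have hfar : ∀ w ∈ J, ∀ z ∉ S, ¬ G.Adj w z := by
      intro w hw z hz hwz
      have h₄ : degreeWithin G (insert z S) w ≤ degreeWithin G univ w :=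
        degreeWithin_mono (subset_univ _) w
      rw [degreeWithin_insert hz, if_pos hwz, hJ.degree_eq w hw, degreeWithin_univ_eq hG] at h₄
      omega
    have hcard := hJ.card_eq
    refine ⟨insert u (insert v J), ?_, ?_, ?_, ?_⟩
    · refine (card_le_card (t := {s(u, v)}) fun x hx => ?_).trans_eq (card_singleton _)
      induction x with | _ a b => ?_
      rw [mk_mem_edgesWithin] at hx
      obtain ⟨hab, ha, hb⟩ := hx
      simp only [mem_insert] at ha hb
      rw [mem_singleton]
      rcases ha with rfl | rfl | ha <;> rcases hb with rfl | rfl | hb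
      · exact (hab.ne rfl).elim
      · rfl
      · exact (hfar b hb _ hu hab.symm).elim
      · exact Sym2.eq_swap
      · exact (hab.ne rfl).elim
      · exact (hfar b hb _ hv hab.symm).elim
      · exact (hfar a ha _ hu hab).elim
      · exact (hfar a ha _ hv hab).elim
      · exact (hJ.not_adj a ha b hb hab).elim
    · rw [hcompl]
      exact hJ.isLinked
    · rw [hcompl]
      exact hJ.card_edgesWithin_sdiff
    · have h₄ := card_insert_le u (insert v J)
      have h₅ := card_insert_le v J
      omega

lemma IsLinked.connected {U : Finset V} (h : IsLinked G U) :
    (G.induce (U : Set V)).Connected := by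
  obtain ⟨⟨v, hv⟩, h⟩ := h
  have : Nonempty (U : Set V) := ⟨⟨v, hv⟩⟩
  refine ⟨fun a b => ?_⟩
  by_contra hab
  obtain ⟨c, hc, d, hd, hcd⟩ := h
    {w ∈ U | ∃ hw : w ∈ U, (G.induce (U : Set V)).Reachable a ⟨w, hw⟩} (filter_subset _ _)
    ⟨a, by simp⟩ (fun h' => by
      have hb : (b : V) ∈ U := b.2
      exact hab (mem_filter.1 (h'.symm.subset hb)).2.2)
  obtain ⟨hcU, hc', hc⟩ := mem_filter.1 hc
  obtain ⟨hdU, hd⟩ := mem_sdiff.1 hd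
  refine hd (mem_filter.2 ⟨hdU, hdU, hc.trans (SimpleGraph.Adj.reachable ?_)⟩)
  exact hcd

lemma ncard_edgeSet_induce (U : Finset V) :
    (G.induce (U : Set V)).edgeSet.ncard = #(edgesWithin G U) := by
  rw [← Set.ncard_image_of_injective _ (Sym2.map.injective Subtype.val_injective),
    ← Set.ncard_coe_finset]
  congr 1
  ext x
  constructor
  · rintro ⟨y, hy, rfl⟩
    induction y with | _ a b => ?_
    exact mk_mem_edgesWithin.2 ⟨hy, a.2, b.2⟩
  · induction x with | _ a b => ?_
    intro h
    obtain ⟨hab, ha, hb⟩ := mk_mem_edgesWithin.1 h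
    exact ⟨s(⟨a, ha⟩, ⟨b, hb⟩), hab, rfl⟩

lemma ncard_edgeSet_lt_of_isAcyclic {W : Type*} [Finite W] [Nonempty W] {H : SimpleGraph W}
    (hH : H.IsAcyclic) : H.edgeSet.ncard + 1 ≤ Nat.card W := by
  obtain ⟨T, hHT, -, hT⟩ := SimpleGraph.Connected.exists_isTree_le_of_le_of_isAcyclic
    (SimpleGraph.connected_top (V := W)) le_top hH
  rw [← (SimpleGraph.isTree_iff_connected_and_card.1 hT).2]
  have := Set.ncard_le_ncard (SimpleGraph.edgeSet_mono hHT) (Set.toFinite _)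
  simpa [Set.ncard] using this

lemma card_edgesWithin_lt_of_isAcyclic {U : Finset V} (hU : U.Nonempty)
    (h : (G.induce (U : Set V)).IsAcyclic) : #(edgesWithin G U) + 1 ≤ #U := by
  have : Nonempty (U : Set V) := hU.to_subtype
  have h' := ncard_edgeSet_lt_of_isAcyclic h
  rwa [ncard_edgeSet_induce, Nat.card_eq_card_toFinset, toFinset_coe] at h'

/-- A forest on m ≥ 1 vertices has at most m - 1 edges, so at least m + 2 edges leave it, while at
most `3 * J.ncard` edges leave `J`. -/
lemma IsDecyclingSet.card_add_two_le [Nonempty V] (hG : IsCubic G) {J : Set V}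
    (hJ : IsDecyclingSet G J) : Fintype.card V + 2 ≤ 4 * J.ncard := by
  have hpos : 0 < Fintype.card V := Fintype.card_pos
  rw [Set.ncard_eq_toFinset_card' J]
  have hcard := card_add_card_compl J.toFinset
  rcases (J.toFinsetᶜ).eq_empty_or_nonempty with h | h
  · rw [h, card_empty] at hcard
    have he := two_mul_card_edgesWithin_univ hG
    omega
  · have h₁ := card_edgesWithin_lt_of_isAcyclic (G := G) h (by rwa [coe_compl, Set.coe_toFinset])
    have h₂ := two_mul_card_edgesWithin_add_card_boundary hG J.toFinset
    have h₃ := two_mul_card_edgesWithin_add_card_boundary hG J.toFinsetᶜ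
    rw [card_boundary_compl] at h₃
    omega

theorem exists_isCoherentDecyclingPartition [Nonempty V] (hG : IsCubic G)
    (h3 : IsEdgeCutBounded 3 G) (hodd : HasNoDisjointOddSides G) :
    ∃ A J : Set V, IsCoherentDecyclingPartition G A J := by
  obtain ⟨J, hJ, hlink, hedges, hcard⟩ := exists_tree_complement hG h3 hodd
  have htree : (G.induce ((Jᶜ : Finset V) : Set V)).IsTree := by
    refine SimpleGraph.isTree_iff_connected_and_card.2 ⟨hlink.connected, ?_⟩
    rw [Nat.card_coe_set_eq, ncard_edgeSet_induce, hedges, Nat.card_eq_card_toFinset, toFinset_coe]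
  refine ⟨((Jᶜ : Finset V) : Set V), J, ⟨?_, ⟨?_, ?_⟩, ?_, htree.2, ?_⟩, htree⟩
  · rw [coe_compl]
    exact isCompl_compl.symm
  · rw [IsDecyclingSet, ← coe_compl]
    exact htree.2
  · intro J' hJ'
    have := hJ'.card_add_two_le hG
    rw [Set.ncard_coe_finset]
    omega
  · rcases Nat.le_one_iff_eq_zero_or_eq_one.1 hJ with h | h
    · left
      intro a ha b hb _ hab
      rw [card_eq_zero] at h
      have : s(a, b) ∈ edgesWithin G J := mk_mem_edgesWithin.2 ⟨hab, ha, hb⟩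
      simp [h] at this
    · right
      rw [IsNearIndependent, ncard_edgeSet_induce, h]
  · have := htree.1.preconnected.subsingleton_connectedComponent
    exact (Finite.card_le_one_iff_subsingleton.2 this).trans one_le_two

end CubicGraphs

/-! ### Contracting one side of a 3-edge-cut -/

section Contraction

open Finset
open scoped Classical

variable {V W W' : Type*} [Fintype V] [Fintype W] [Fintype W']
  {G : SimpleGraph V} {H : SimpleGraph W} {K : SimpleGraph W'}

/-- `f` contracts the complement of `S` to the vertex `x`, and identifies the graph obtained from
`G` with the simple graph `H`. -/
structure IsContraction (G : SimpleGraph V) (H : SimpleGraph W) (f : V → W) (S : Finset V)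
    (x : W) : Prop where
  surjective : Function.Surjective f
  apply_eq_iff : ∀ v, f v = x ↔ v ∉ S
  injOn : ∀ u ∈ S, ∀ v ∈ S, f u = f v → u = v
  adj : ∀ a b, G.Adj a b → f a ≠ f b → H.Adj (f a) (f b)
  lift : ∀ c d, H.Adj c d → ∃ a b, G.Adj a b ∧ f a = c ∧ f b = d
  unique_out : ∀ a ∈ S, ∀ b ∉ S, ∀ b' ∉ S, G.Adj a b → G.Adj a b' → b = b'

/-- The preimage of a finite set under `f`. -/
noncomputable def pullback (f : V → W) (T : Finset W) : Finset V := {v | f v ∈ T}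

@[simp] lemma mem_pullback {f : V → W} {T : Finset W} {v : V} : v ∈ pullback f T ↔ f v ∈ T := by
  simp [pullback]

namespace IsContraction

variable {f : V → W} {S : Finset V} {x : W}

/-- The contracted graph is simple because no vertex of `S` has two neighbours outside `S`; hence
each edge of `H` comes from a single edge of `G`. -/
lemma unique (h : IsContraction G H f S x) {a b a' b' : V} (hab : G.Adj a b) (hab' : G.Adj a' b')
    (ha : f a = f a') (hb : f b = f b') (hne : f a ≠ f b) : a = a' ∧ b = b' := by
  have key : ∀ {a b a' b' : V}, G.Adj a b → G.Adj a' b' → f a = f a' → f b = f b' → a ∈ S →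
      a = a' ∧ b = b' := by
    intro a b a' b' hab hab' ha hb haS
    have haS' : a' ∈ S := by
      by_contra h'
      exact (h.apply_eq_iff a).1 (ha.trans ((h.apply_eq_iff a').2 h')) haS
    obtain rfl := h.injOn a haS a' haS' ha
    refine ⟨rfl, ?_⟩
    by_cases hbS : b ∈ S
    · refine h.injOn b hbS b' ?_ hb
      by_contra h'
      exact (h.apply_eq_iff b).1 (hb.trans ((h.apply_eq_iff b').2 h')) hbS
    · exact h.unique_out a haS b hbS b'
        ((h.apply_eq_iff b').1 (hb.symm.trans ((h.apply_eq_iff b).2 hbS))) hab hab'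
  by_cases haS : a ∈ S
  · exact key hab hab' ha hb haS
  · have hbS : b ∈ S := by
      by_contra h'
      exact hne (((h.apply_eq_iff a).2 haS).trans ((h.apply_eq_iff b).2 h').symm)
    exact (key hab.symm hab'.symm hb ha hbS).symm

lemma card_boundary_pullback (h : IsContraction G H f S x) (T : Finset W) :
    #(boundary G (pullback f T)) = #(boundary H T) := by
  refine card_bij (fun p _ => (f p.1, f p.2)) ?_ ?_ ?_
  · intro p hp
    simp only [boundary, mem_filter, mem_univ, true_and, mem_pullback] at hp ⊢
    exact ⟨h.adj _ _ hp.1 fun h' => hp.2.2 (h' ▸ hp.2.1), hp.2⟩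
  · intro p hp q hq hpq
    simp only [boundary, mem_filter, mem_univ, true_and, mem_pullback] at hp hq
    rw [Prod.mk.injEq] at hpq
    have := h.unique hp.1 hq.1 hpq.1 hpq.2 fun h' => hp.2.2 (h' ▸ hp.2.1)
    exact Prod.ext this.1 this.2
  · rintro ⟨c, d⟩ hcd
    simp only [boundary, mem_filter, mem_univ, true_and] at hcd
    obtain ⟨a, b, hab, rfl, rfl⟩ := h.lift c d hcd.1
    exact ⟨(a, b), by simpa [boundary] using ⟨hab, hcd.2⟩, rfl⟩

lemma card_pullback_of_notMem (h : IsContraction G H f S x) {T : Finset W} (hx : x ∉ T) :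
    #(pullback f T) = #T := by
  have hS : ∀ v ∈ pullback f T, v ∈ S := by
    intro v hv
    by_contra h'
    exact hx ((h.apply_eq_iff v).2 h' ▸ mem_pullback.1 hv)
  refine card_bij (fun v _ => f v) (fun v hv => mem_pullback.1 hv)
    (fun u hu v hv => h.injOn u (hS u hu) v (hS v hv)) fun w hw => ?_
  obtain ⟨v, rfl⟩ := h.surjective w
  exact ⟨v, mem_pullback.2 hw, rfl⟩

lemma card_pullback_of_mem (h : IsContraction G H f S x) {T : Finset W} (hx : x ∈ T) :
    #(pullback f T) + 1 = #T + #Sᶜ := by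
  have h₁ := h.card_pullback_of_notMem (notMem_erase x T)
  have h₂ := card_erase_add_one hx
  have h₃ : pullback f T = pullback f (T.erase x) ∪ Sᶜ := by
    ext v
    simp only [mem_pullback, mem_union, mem_erase, mem_compl, ← h.apply_eq_iff]
    constructor
    · intro hv
      by_cases hvx : f v = x
      · exact Or.inr hvx
      · exact Or.inl ⟨hvx, hv⟩
    · rintro (hv | hv)
      · exact hv.2
      · rwa [hv]
  rw [h₃, card_union_of_disjoint]
  · omega
  · rw [disjoint_left]
    intro v hv hv'
    exact (mem_erase.1 (mem_pullback.1 hv)).1 ((h.apply_eq_iff v).2 (mem_compl.1 hv'))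

lemma pullback_compl_singleton (h : IsContraction G H f S x) : pullback f {x}ᶜ = S := by
  ext v
  simp [h.apply_eq_iff]

lemma exists_eq_pullback (h : IsContraction G H f S x) {U : Finset V}
    (hU : U ⊆ S ∨ Sᶜ ⊆ U) : ∃ T, U = pullback f T := by
  refine ⟨U.image f, ?_⟩
  ext v
  simp only [mem_pullback, mem_image]
  refine ⟨fun hv => ⟨v, hv, rfl⟩, ?_⟩
  rintro ⟨u, hu, huv⟩
  by_cases hvS : v ∈ S
  · have huS : u ∈ S := by
      by_contra h'
      exact (h.apply_eq_iff v).1 (huv.symm.trans ((h.apply_eq_iff u).2 h')) hvS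
    rwa [← h.injOn u huS v hvS huv]
  · have huS := (h.apply_eq_iff u).1 (huv.trans ((h.apply_eq_iff v).2 hvS))
    rcases hU with hU | hU
    · exact (huS (hU hu)).elim
    · exact hU (mem_compl.2 hvS)

/-- Cuts of `H` pull back to cuts of `G` of equal size. Thus edge-connectivity passes to the
summands of a 3-sum, which the induction over the decomposition needs. -/
lemma isEdgeCutBounded (h : IsContraction G H f S x) {k : ℕ} (hG : IsEdgeCutBounded k G) :
    IsEdgeCutBounded k H := by
  intro T hT hT'
  rw [← h.card_boundary_pullback]
  obtain ⟨c, hc⟩ := hT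
  obtain ⟨d, hd⟩ := hT'
  obtain ⟨a, rfl⟩ := h.surjective c
  obtain ⟨b, rfl⟩ := h.surjective d
  exact hG _ ⟨a, mem_pullback.2 hc⟩
    ⟨b, mem_compl.2 fun hb => mem_compl.1 hd (mem_pullback.1 hb)⟩

end IsContraction

/-- All sides of `3`-edge-cuts have `1` modulo `4` vertices, that is, an even Betti number. -/
def HasEvenSides (G : SimpleGraph V) : Prop :=
  ∀ S : Finset V, #(boundary G S) = 3 → #S % 4 = 1

lemma card_boundary_compl_singleton (hH : IsCubic H) (x : W) : #(boundary H {x}ᶜ) = 3 := by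
  rw [card_boundary_compl]
  have h := two_mul_card_edgesWithin_add_card_boundary hH {x}
  simpa [edgesWithin_singleton] using h

/-- In a cubic graph `3`-edge-cuts do not cross. -/
lemma not_crossing (hG : IsCubic G) (h3 : IsEdgeCutBounded 3 G) {S T : Finset V}
    (hS : #(boundary G S) = 3) (hT : #(boundary G T) = 3) :
    (S ⊆ T ∨ Tᶜ ⊆ S) ∨ (S ⊆ Tᶜ ∨ T ⊆ S) := by
  by_contra! h
  obtain ⟨⟨h₁, h₂⟩, h₃, h₄⟩ := h
  obtain ⟨a, ha, haT⟩ := not_subset.1 h₁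
  obtain ⟨b, hb, hbS⟩ := not_subset.1 h₂
  obtain ⟨c, hc, hcT⟩ := not_subset.1 h₃
  obtain ⟨d, hd, hdS⟩ := not_subset.1 h₄
  simp only [mem_compl, not_not] at hb hcT
  -- Submodularity forces both corners to have boundary exactly 3, hence odd size. For `R = T` and
  -- `R = Tᶜ` this makes `#S` even, although its boundary is 3.
  have key : ∀ R : Finset V, #(boundary G R) = 3 → (S ∩ R).Nonempty → (S ∪ R)ᶜ.Nonempty →
      #(S ∩ R) % 2 = 1 := by
    intro R hR hn hn'
    have h₁ := card_boundary_inter_add_union_le (G := G) S R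
    have h₂ := h3 (S ∩ R) hn (hn'.mono (compl_subset_compl.2
      (inter_subset_left.trans subset_union_left)))
    have h₃ := h3 (S ∪ R) (hn.mono (inter_subset_left.trans subset_union_left)) hn'
    have h₄ := two_mul_card_edgesWithin_add_card_boundary hG (S ∩ R)
    omega
  have h₅ := key T hT ⟨c, by simp [hc, hcT]⟩ ⟨b, by simp [hb, hbS]⟩
  have h₆ := key Tᶜ (by rwa [card_boundary_compl]) ⟨a, by simp [ha, haT]⟩
    ⟨d, by simp [hd, hdS]⟩
  have h₇ := two_mul_card_edgesWithin_add_card_boundary hG S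
  have h₈ := card_inter_add_card_sdiff S T
  rw [sdiff_eq_inter_compl] at h₈
  omega

variable {f : V → W} {g : V → W'} {S : Finset V} {x : W} {y : W'}

lemma exists_pullback_of_card_boundary (hG : IsCubic G) (h3 : IsEdgeCutBounded 3 G)
    (hH : IsCubic H) (hf : IsContraction G H f S x) (hg : IsContraction G K g Sᶜ y)
    {U : Finset V} (hU : #(boundary G U) = 3) :
    (∃ T, #(boundary H T) = 3 ∧ U = pullback f T) ∨
      ∃ T, #(boundary K T) = 3 ∧ U = pullback g T := by
  have hS : #(boundary G S) = 3 := by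
    rw [← hf.pullback_compl_singleton, hf.card_boundary_pullback,
      card_boundary_compl_singleton hH]
  rcases not_crossing hG h3 hU hS with h | h
  · obtain ⟨T, rfl⟩ := hf.exists_eq_pullback h
    exact Or.inl ⟨T, by rwa [hf.card_boundary_pullback] at hU, rfl⟩
  · obtain ⟨T, rfl⟩ := hg.exists_eq_pullback (by rwa [compl_compl])
    exact Or.inr ⟨T, by rwa [hg.card_boundary_pullback] at hU, rfl⟩

/-- The pullback replaces `x` by `Sᶜ`, which is a side of a 3-edge-cut of `K` and so has 1 modulo 4
vertices. -/
lemma HasEvenSides.card_pullback_mod_four (hK : IsCubic K) (hKe : HasEvenSides K)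
    (hf : IsContraction G H f S x) (hg : IsContraction G K g Sᶜ y) (T : Finset W) :
    #(pullback f T) % 4 = #T % 4 := by
  have h₁ : #Sᶜ % 4 = 1 := by
    rw [← hg.pullback_compl_singleton, hg.card_pullback_of_notMem (by simp)]
    exact hKe _ (card_boundary_compl_singleton hK y)
  by_cases hx : x ∈ T
  · have := hf.card_pullback_of_mem hx
    omega
  · rw [hf.card_pullback_of_notMem hx]

lemma HasEvenSides.of_contractions (hG : IsCubic G) (h3 : IsEdgeCutBounded 3 G) (hH : IsCubic H)
    (hK : IsCubic K) (hf : IsContraction G H f S x) (hg : IsContraction G K g Sᶜ y)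
    (hHe : HasEvenSides H) (hKe : HasEvenSides K) : HasEvenSides G := by
  intro U hU
  rcases exists_pullback_of_card_boundary hG h3 hH hf hg hU with ⟨T, hT, rfl⟩ | ⟨T, hT, rfl⟩
  · rw [hKe.card_pullback_mod_four hK hf hg]
    exact hHe T hT
  · rw [hHe.card_pullback_mod_four hH hg (by rwa [compl_compl])]
    exact hKe T hT

/-- An odd side of `G` is either pulled back from an odd side of `H` or contains `S`. Two of the
second kind share `S`, and one of each kind meet because an odd side of `H` is not contained in
`{x}`. -/
lemma HasNoDisjointOddSides.of_contractions (hG : IsCubic G) (h3 : IsEdgeCutBounded 3 G)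
    (hH : IsCubic H) (hK : IsCubic K) (hf : IsContraction G H f S x)
    (hg : IsContraction G K g Sᶜ y) (hHo : HasNoDisjointOddSides H) (hKe : HasEvenSides K) :
    HasNoDisjointOddSides G := by
  have hside : ∀ U, IsOddSide G U →
      (∃ T, IsOddSide H T ∧ U = pullback f T) ∨ S ⊆ U := by
    intro U hU
    rcases exists_pullback_of_card_boundary hG h3 hH hf hg hU.1 with ⟨T, hT, rfl⟩ | ⟨T, hT, rfl⟩
    · refine Or.inl ⟨T, ⟨hT, ?_⟩, rfl⟩
      rw [← hKe.card_pullback_mod_four hK hf hg]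
      exact hU.2
    · right
      have h₁ := hKe T hT
      have h₂ := hU.2
      by_cases hy : y ∈ T
      · intro v hv
        rw [mem_pullback, (hg.apply_eq_iff v).2 (by simpa using hv)]
        exact hy
      · rw [hg.card_pullback_of_notMem hy] at h₂
        omega
  have hmix : ∀ T U, IsOddSide H T → S ⊆ U → ¬ Disjoint (pullback f T) U := by
    intro T U hT hSU hd
    have : T ⊆ {x} := by
      intro w hw
      obtain ⟨v, rfl⟩ := hf.surjective w
      rw [mem_singleton, hf.apply_eq_iff]
      exact fun hv => disjoint_left.1 hd (mem_pullback.2 hw) (hSU hv)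
    have h₁ := card_le_card this
    have h₂ := hT.2
    rw [card_singleton] at h₁
    omega
  intro U U' hd hU hU'
  rcases hside U hU with ⟨T, hT, rfl⟩ | hSU <;> rcases hside U' hU' with ⟨T', hT', rfl⟩ | hSU'
  · refine hHo T T' (disjoint_left.2 fun w hw hw' => ?_) hT hT'
    obtain ⟨v, rfl⟩ := hf.surjective w
    exact disjoint_left.1 hd (mem_pullback.2 hw) (mem_pullback.2 hw')
  · exact hmix T U' hT hSU' hd
  · exact hmix T' U hT' hSU hd.symm
  · obtain ⟨v, hv⟩ : S.Nonempty := by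
      rw [nonempty_iff_ne_empty]
      rintro rfl
      have := card_boundary_compl_singleton hH x
      rw [← hf.card_boundary_pullback, hf.pullback_compl_singleton] at this
      simp [boundary] at this
    exact disjoint_left.1 hd (hSU hv) (hSU' hv)

end Contraction

/-! ### Rooted sums contract onto their summands -/

section RootedSum

open scoped Classical

variable {U V W : Type*}

/-- The map of a rooted sum onto its first summand. -/
def rootedSumProj (x : V) (y : W) : {a : V // a ≠ x} ⊕ {b : W // b ≠ y} → V :=
  Sum.elim Subtype.val fun _ => x

/-- Rooted sums are symmetric. -/
def rootedSumComm (H : SimpleGraph V) (x : V) (K : SimpleGraph W) (y : W)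
    (σ : H.neighborSet x ≃ K.neighborSet y) :
    rootedSum H x K y σ ≃g rootedSum K y H x σ.symm where
  toEquiv := Equiv.sumComm _ _
  map_rel_iff' := by
    have key : ∀ (a : {a : V // a ≠ x}) (b : {b : W // b ≠ y}),
        (∃ h : (b : W) ∈ K.neighborSet y, (σ.symm ⟨b, h⟩ : V) = a) ↔
          ∃ h : (a : V) ∈ H.neighborSet x, (σ ⟨a, h⟩ : W) = b := by
      rintro ⟨a, ha⟩ ⟨b, hb⟩
      constructor
      · rintro ⟨h, rfl⟩
        exact ⟨(σ.symm ⟨b, h⟩).2, by simp⟩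
      · rintro ⟨h, rfl⟩
        exact ⟨(σ ⟨a, h⟩).2, by simp⟩
    rintro (a | b) (a' | b')
    · exact Iff.rfl
    · exact key a b'
    · exact key a' b
    · exact Iff.rfl

lemma isContraction_rootedSumProj [Fintype U] {G : SimpleGraph U} {H : SimpleGraph V}
    {K : SimpleGraph W} {x : V} {y : W} (hK : IsCubic K) {σ : H.neighborSet x ≃ K.neighborSet y}
    (e : G ≃g rootedSum H x K y σ) :
    IsContraction G H (rootedSumProj x y ∘ e) {u | (e u).isLeft} x where
  surjective v := by
    by_cases hv : v = x
    -- The root `x` is the image of `K - y`, which is nonempty because `y` has neighbours.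
    · obtain ⟨b, hb⟩ : (K.neighborSet y).Nonempty :=
        Set.nonempty_of_ncard_ne_zero (by rw [hK y]; omega)
      exact ⟨e.symm (Sum.inr ⟨b, K.ne_of_adj hb |>.symm⟩), by simp [rootedSumProj, hv]⟩
    · exact ⟨e.symm (Sum.inl ⟨v, hv⟩), by simp [rootedSumProj]⟩
  apply_eq_iff u := by
    rcases h : e u with a | b
    · simpa [h, rootedSumProj] using a.2
    · simp [h, rootedSumProj]
  injOn u hu v hv huv := by
    apply e.injective
    rcases h : e u with a | b <;> rcases h' : e v with a' | b'
    · simp only [Function.comp, h, h', rootedSumProj, Sum.elim_inl] at huv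
      rw [Subtype.ext huv]
    · simp [h'] at hv
    · simp [h] at hu
    · simp [h] at hu
  adj u v huv := by
    rw [← e.map_adj_iff] at huv
    simp only [Function.comp]
    rcases h : e u with a | b <;> rcases h' : e v with a' | b' <;> rw [h, h'] at huv
    · exact fun _ => huv
    · exact fun _ => huv.1.symm
    · exact fun _ => huv.1
    · exact fun h => (h rfl).elim
  lift c d hcd := by
    by_cases hc : c = x
    · subst hc
      refine ⟨e.symm (Sum.inr ⟨σ ⟨d, hcd⟩, (K.ne_of_adj (σ ⟨d, hcd⟩).2).symm⟩),
        e.symm (Sum.inl ⟨d, hcd.ne'⟩), ?_, ?_, ?_⟩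
      · rw [e.symm.map_adj_iff]
        exact ⟨hcd, rfl⟩
      · simp [rootedSumProj]
      · simp [rootedSumProj]
    · by_cases hd : d = x
      · subst hd
        refine ⟨e.symm (Sum.inl ⟨c, hc⟩),
          e.symm (Sum.inr ⟨σ ⟨c, hcd.symm⟩, (K.ne_of_adj (σ ⟨c, hcd.symm⟩).2).symm⟩), ?_, ?_, ?_⟩
        · rw [e.symm.map_adj_iff]
          exact ⟨hcd.symm, rfl⟩
        · simp [rootedSumProj]
        · simp [rootedSumProj]
      · refine ⟨e.symm (Sum.inl ⟨c, hc⟩), e.symm (Sum.inl ⟨d, hd⟩), ?_, ?_, ?_⟩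
        · rw [e.symm.map_adj_iff]
          exact hcd
        · simp [rootedSumProj]
        · simp [rootedSumProj]
  unique_out u hu v hv v' hv' huv huv' := by
    apply e.injective
    rw [← e.map_adj_iff] at huv huv'
    simp only [Finset.mem_filter, Finset.mem_univ, true_and] at hu hv hv'
    rcases h : e u with a | a <;> rcases h' : e v with b | b <;> rcases h'' : e v' with c | c <;>
      simp only [h, h', h'', Sum.isLeft_inl, Sum.isLeft_inr, not_true_eq_false,
        Bool.false_eq_true] at hu hv hv'
    rw [h, h'] at huv
    rw [h, h''] at huv'
    obtain ⟨_, h₁⟩ := huv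
    obtain ⟨_, h₂⟩ := huv'
    rw [Subtype.ext (h₁.symm.trans h₂)]

end RootedSum

/-! ### Small cuts in cyclically 4-edge-connected cubic graphs -/

section Factors

open Finset
open scoped Classical

variable {V : Type*}

lemma not_isAcyclic_connectedComponentMk {D : SimpleGraph V} {v : V} {w : D.Walk v v}
    (hw : w.IsCycle) : ¬ (D.connectedComponentMk v).toSimpleGraph.IsAcyclic := by
  intro h
  have hs : ∀ u ∈ w.support, u ∈ (D.connectedComponentMk v).supp := fun u hu =>
    SimpleGraph.ConnectedComponent.sound (w.takeUntil u hu).reachable.symm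
  have h' : (D.induce (D.connectedComponentMk v).supp).IsAcyclic := h
  refine h' (w.induce _ hs) ?_
  rw [← SimpleGraph.Walk.isCycle_map_iff_of_injective
    (f := (SimpleGraph.Embedding.induce (G := D) (D.connectedComponentMk v).supp).toHom)
    Subtype.val_injective, SimpleGraph.Walk.map_induce]
  exact hw

lemma exists_not_isAcyclic_component {G D : SimpleGraph V} {S : Set V}
    (hD : ∀ a ∈ S, ∀ b ∈ S, G.Adj a b → D.Adj a b) (hS : ¬ (G.induce S).IsAcyclic) :
    ∃ v ∈ S, ¬ (D.connectedComponentMk v).toSimpleGraph.IsAcyclic := by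
  rw [SimpleGraph.IsAcyclic] at hS
  push Not at hS
  obtain ⟨v, w, hw⟩ := hS
  let φ : G.induce S →g D := ⟨Subtype.val, fun {a b} h => hD a a.2 b b.2 h⟩
  exact ⟨v, v.2, not_isAcyclic_connectedComponentMk (w := w.map φ)
    ((SimpleGraph.Walk.isCycle_map_iff_of_injective Subtype.val_injective).2 hw)⟩

lemma mem_of_reachable {D : SimpleGraph V} {S : Set V}
    (hD : ∀ a ∈ S, ∀ b, D.Adj a b → b ∈ S) {a b : V} (h : D.Reachable a b) (ha : a ∈ S) :
    b ∈ S := by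
  obtain ⟨w⟩ := h
  induction w with
  | nil => exact ha
  | cons hab _ ih => exact ih (hD _ ha _ hab)

variable [Fintype V] {G : SimpleGraph V}

/-- Cycles on both sides would lie in different components once the three cut edges are deleted. -/
lemma IsCyclicallyEdgeConnected.isAcyclic_or_isAcyclic
    (hconn : IsCyclicallyEdgeConnected 4 G) {S : Finset V} (hS : #(boundary G S) = 3) :
    (G.induce (S : Set V)).IsAcyclic ∨ (G.induce ((Sᶜ : Finset V) : Set V)).IsAcyclic := by
  by_contra! h
  set B : Finset (Sym2 V) := (boundary G S).image fun p => s(p.1, p.2) with hB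
  have hmem : ∀ a ∈ S, ∀ b ∉ S, G.Adj a b → s(a, b) ∈ B := fun a ha b hb hab =>
    mem_image.2 ⟨(a, b), by simp [boundary, ha, hb, hab], rfl⟩
  have hmem' : ∀ a b, s(a, b) ∈ B → (a ∈ S ∧ b ∉ S) ∨ (b ∈ S ∧ a ∉ S) := by
    intro a b hab
    obtain ⟨⟨c, d⟩, hcd, h⟩ := mem_image.1 hab
    simp only [boundary, mem_filter] at hcd
    rcases Sym2.eq_iff.1 h with ⟨rfl, rfl⟩ | ⟨rfl, rfl⟩
    · exact Or.inl hcd.2.2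
    · exact Or.inr hcd.2.2
  have hlt : (B : Set (Sym2 V)).encard < (4 : ℕ) := by
    rw [Set.encard_coe_eq_coe_finsetCard]
    have : #B ≤ 3 := card_image_le.trans hS.le
    exact_mod_cast Nat.lt_succ_of_le this
  refine hconn.2 B hlt ⟨?_, ?_⟩
  · intro e he
    obtain ⟨p, hp, rfl⟩ := mem_image.1 he
    exact (mem_filter.1 hp).2.1
  · set D := G.deleteEdges (B : Set (Sym2 V)) with hD
    have hDadj : ∀ a b, D.Adj a b ↔ G.Adj a b ∧ s(a, b) ∉ B := by simp [hD]
    obtain ⟨v, hv, hv'⟩ := exists_not_isAcyclic_component (D := D) (fun a ha b hb hab =>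
      (hDadj a b).2 ⟨hab, fun h' => by
        rw [mem_coe] at ha hb
        have := hmem' a b h'
        tauto⟩) h.1
    obtain ⟨u, hu, hu'⟩ := exists_not_isAcyclic_component (D := D) (fun a ha b hb hab =>
      (hDadj a b).2 ⟨hab, fun h' => by
        rw [mem_coe, mem_compl] at ha hb
        have := hmem' a b h'
        tauto⟩) h.2
    refine ⟨_, _, fun heq => ?_, hv', hu'⟩
    refine mem_compl.1 (mem_coe.1 hu) (mem_coe.1 (mem_of_reachable (D := D) (S := (S : Set V)) ?_
      (SimpleGraph.ConnectedComponent.exact heq) hv))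
    intro a ha b hab
    by_contra hb
    rw [hDadj] at hab
    exact hab.2 (hmem a ha b hb hab.1)

/-- Within `S` there are `(3 * #S - 3) / 2` edges, and a forest has at most `#S - 1`. -/
lemma card_le_one_of_isAcyclic (hG : IsCubic G) {S : Finset V} (hS : #(boundary G S) = 3)
    (h : (G.induce (S : Set V)).IsAcyclic) : #S = 1 := by
  have h₁ := two_mul_card_edgesWithin_add_card_boundary hG S
  have h₂ := card_edgesWithin_lt_of_isAcyclic (G := G) (card_pos.1 (by omega)) h
  omega

lemma IsCyclicallyEdgeConnected.card_eq_one_or (hG : IsCubic G)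
    (hconn : IsCyclicallyEdgeConnected 4 G) {S : Finset V} (hS : #(boundary G S) = 3) :
    #S = 1 ∨ #S + 1 = Fintype.card V := by
  rcases hconn.isAcyclic_or_isAcyclic hS with h | h
  · exact Or.inl (card_le_one_of_isAcyclic hG hS h)
  · have h₁ := card_le_one_of_isAcyclic hG (by rwa [card_boundary_compl]) h
    have h₂ := card_add_card_compl S
    omega

/-- A cubic graph on n vertices has 3n/2 edges, so its Betti number is n/2 + 1. -/
lemma isCyclicallyOdd_iff (hG : IsCubic G) : IsCyclicallyOdd G ↔ Fintype.card V % 4 = 0 := by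
  have h₁ := two_mul_card_edgesWithin_univ hG
  have h₂ : G.edgeSet.ncard = #(edgesWithin G univ) := by
    rw [← Set.ncard_coe_finset]
    congr 1
    ext x
    simp [edgesWithin]
  rw [IsCyclicallyOdd, bettiNumber, h₂, Nat.card_eq_fintype_card, Int.odd_iff]
  omega

lemma IsCyclicallyEdgeConnected.hasEvenSides (hG : IsCubic G)
    (hconn : IsCyclicallyEdgeConnected 4 G) (heven : ¬ IsCyclicallyOdd G) : HasEvenSides G := by
  intro S hS
  have h₁ := two_mul_card_edgesWithin_univ hG
  rw [isCyclicallyOdd_iff hG] at heven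
  rcases hconn.card_eq_one_or hG hS with h | h <;> omega

/-- An odd side is too large to be a single vertex, so it omits exactly one vertex; two such sets
overlap. -/
lemma IsCyclicallyEdgeConnected.hasNoDisjointOddSides (hG : IsCubic G)
    (hconn : IsCyclicallyEdgeConnected 4 G) : HasNoDisjointOddSides G := by
  intro S T hd hS hT
  have h₁ := card_union_of_disjoint hd
  have h₂ := card_le_univ (S ∪ T)
  have h₃ := hS.2
  have h₄ := hT.2
  rcases hconn.card_eq_one_or hG hS.1 with h | h <;>
    rcases hconn.card_eq_one_or hG hT.1 with h' | h' <;> omega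

end Factors

/-! ### Induction over the canonical decomposition -/

section Decomposition

open scoped Classical

universe u

lemma IsThreeSum.exists_contractions {U V W : Type u} [Fintype U] [Fintype V] [Fintype W]
    {G : SimpleGraph U} {H : SimpleGraph V} {K : SimpleGraph W} (h : IsThreeSum G H K) :
    ∃ (f : U → V) (g : U → W) (S : Finset U) (x : V) (y : W),
      IsContraction G H f S x ∧ IsContraction G K g Sᶜ y := by
  obtain ⟨hH, hK, x, y, σ, ⟨e⟩⟩ := h
  refine ⟨_, rootedSumProj y x ∘ e.trans (rootedSumComm H x K y σ), _, x, y,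
    isContraction_rootedSumProj hK e, ?_⟩
  convert isContraction_rootedSumProj hH (e.trans (rootedSumComm H x K y σ)) using 1
  ext u
  rcases h : e u with a | b <;> simp [h, rootedSumComm]

lemma IsThreeSum.finite {U V W : Type u} [Finite U] {G : SimpleGraph U} {H : SimpleGraph V}
    {K : SimpleGraph W} (h : IsThreeSum G H K) : Finite V ∧ Finite W := by
  obtain ⟨-, -, x, y, σ, ⟨e⟩⟩ := h
  have : Finite ({a : V // a ≠ x} ⊕ {b : W // b ≠ y}) := Finite.of_equiv U e.toEquiv
  have h₁ : Finite {a : V // a ≠ x} := Finite.sum_left {b : W // b ≠ y}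
  have h₂ : Finite {b : W // b ≠ y} := Finite.sum_right {a : V // a ≠ x}
  constructor
  · exact Set.finite_univ_iff.1 ((Set.Finite.insert x (s := {a | a ≠ x}) h₁).subset
      fun a _ => Classical.em (a = x))
  · exact Set.finite_univ_iff.1 ((Set.Finite.insert y (s := {b | b ≠ y}) h₂).subset
      fun b _ => Classical.em (b = y))

/-- The odd sides of `3`-edge-cuts are controlled by the odd factors. -/
theorem IsCanonicalDecomposition.oddSides {V : Type u} {G : SimpleGraph V}
    {L : Multiset BundledGraph.{u}} (hL : IsCanonicalDecomposition G L) :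
    ∀ [Fintype V], IsCubic G → IsEdgeCutBounded 3 G →
      (cyclicallyOddCount L = 0 → HasEvenSides G) ∧
        (cyclicallyOddCount L ≤ 1 → HasNoDisjointOddSides G) := by
  induction hL with
  | factor G _ hconn =>
    intro _ hG h3
    refine ⟨fun h => hconn.hasEvenSides hG fun hodd => ?_,
      fun _ => hconn.hasNoDisjointOddSides hG⟩
    rw [cyclicallyOddCount, Multiset.countP_eq_zero] at h
    exact h _ (Multiset.mem_singleton_self _) hodd
  | @sum U V W G H K L M _ _ hsum ihH ihK =>
    intro _ hG h3
    obtain ⟨hV, hW⟩ := hsum.finite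
    have := Fintype.ofFinite V
    have := Fintype.ofFinite W
    obtain ⟨f, g, S, x, y, hf, hg⟩ := hsum.exists_contractions
    have hf' : IsContraction G H f Sᶜᶜ x := by rwa [compl_compl]
    have hH := hsum.1
    have hK := hsum.2.1
    obtain ⟨hH₀, hH₁⟩ := ihH hH (hf.isEdgeCutBounded h3)
    obtain ⟨hK₀, hK₁⟩ := ihK hK (hg.isEdgeCutBounded h3)
    have hcount : cyclicallyOddCount (L + M) = cyclicallyOddCount L + cyclicallyOddCount M :=
      Multiset.countP_add ..
    rw [hcount]
    constructor
    · intro h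
      exact .of_contractions hG h3 hH hK hf hg (hH₀ (by omega)) (hK₀ (by omega))
    · intro h
      -- At least one summand has no odd factor and plays the role of the even one; if it is `H`,
      -- the summands are exchanged.
      by_cases hM : cyclicallyOddCount M = 0
      · exact .of_contractions hG h3 hH hK hf hg (hH₁ (by omega)) (hK₀ hM)
      · exact .of_contractions hG h3 hK hH hg hf' (hK₁ (by omega)) (hH₀ (by omega))

end Decomposition

/-! ### From vertex-connectivity to edge-connectivity -/

section VertexConnectivity

open Finset
open scoped Classical

variable {V : Type*} [Fintype V] {G : SimpleGraph V}

/-- Cubic graphs which are `3`-connected are `3`-edge-connected. -/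
lemma IsVertexConnected.isEdgeCutBounded (hG : IsCubic G) (hconn : IsVertexConnected 3 G) :
    IsEdgeCutBounded 3 G := by
  intro S hS ⟨b, hb⟩
  by_contra! hlt
  -- A set of one or two vertices has at least 3 boundary edges, since the graph is simple and
  -- cubic.
  have hcard : 3 ≤ #S := by
    have h₁ := two_mul_card_edgesWithin_add_card_boundary hG S
    have h₂ := sum_degreeWithin (G := G) S
    have h₃ : ∀ v ∈ S, degreeWithin G S v ≤ #S - 1 := by
      intro v hv
      rw [← card_erase_of_mem hv]
      refine card_le_card fun w hw => ?_
      rw [mem_filter] at hw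
      exact mem_erase.2 ⟨hw.2.ne', hw.1⟩
    have h₄ := sum_le_card_nsmul S _ _ h₃
    have h₅ := card_pos.2 hS
    by_contra! h₆
    rw [h₂, smul_eq_mul] at h₄
    generalize #S = s at *
    interval_cases s <;> omega
  -- Deleting the ends in `S` of the cut edges removes at most two vertices and separates the rest
  -- of `S` from `b`.
  set X := (boundary G S).image Prod.fst with hX
  have hXcard : #X < 3 := card_image_le.trans_lt hlt
  obtain ⟨a, ha⟩ : (S \ X).Nonempty := by
    rw [← card_pos]
    have := le_card_sdiff X S
    omega
  rw [mem_sdiff] at ha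
  have hXS : ∀ v ∈ X, v ∈ S := by
    intro v hv
    obtain ⟨p, hp, rfl⟩ := mem_image.1 hv
    exact (mem_filter.1 hp).2.2.1
  have hbX : b ∉ X := fun h => mem_compl.1 hb (hXS b h)
  have hreach := (hconn.2 (X : Set V) (by rwa [Set.ncard_coe_finset])).preconnected
    ⟨a, by simpa using ha.2⟩ ⟨b, by simpa using hbX⟩
  refine mem_compl.1 hb (mem_of_reachable (D := G.induce (X : Set V)ᶜ)
    (S := {v | (v : V) ∈ S}) ?_ hreach ha.1)
  intro v hv w hvw
  by_contra hw
  exact v.2 (mem_coe.2 (mem_image.2 ⟨((v : V), (w : V)), by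
    simp only [boundary, mem_filter, mem_univ, true_and]
    exact ⟨hvw, hv, hw⟩, rfl⟩))

end VertexConnectivity

end CubicDecycling

theorem theorem6p2 {V : Type*} [Finite V] (G : SimpleGraph V)
    (hcubic : CubicDecycling.IsCubic G)
    (hconn : CubicDecycling.IsVertexConnected 3 G)
    (L : Multiset CubicDecycling.BundledGraph)
    (hL : CubicDecycling.IsCanonicalDecomposition G L)
    (hodd : CubicDecycling.cyclicallyOddCount L ≤ 1) :
    ∃ A J : Set V, CubicDecycling.IsCoherentDecyclingPartition G A J := by
  have := Fintype.ofFinite V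
  have : Nonempty V := (Nat.card_pos_iff.1 (Nat.zero_lt_of_lt hconn.1)).1
  have h3 := CubicDecycling.IsVertexConnected.isEdgeCutBounded hcubic hconn
  exact CubicDecycling.exists_isCoherentDecyclingPartition hcubic h3
    ((hL.oddSides hcubic h3).2 hodd)
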